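/- Let $n$ be a natural number, let $\pi:\mathbb{C}^n\times\mathbb{C}\to\mathbb{C}$ be the projection onto the second factor, let $D\subset\mathbb{C}^{n}\times\mathbb{C}=\mathbb{C}^{n+1}$ be a domain (a non-empty connected open set), put $S:=\pi(D)$, and for $y\in S$ let $D_y:=\{z\in\mathbb{C}^n:(z,y)\in D\}$, identified with $D\cap\pi^{-1}(y)$. Suppose that $D$ is a holomorphic family of bounded strongly pseudoconvex domains, that is: (i) the boundary of $D$ over $S$, $\pi^{-1}(S)\cap\partial D$, is smooth (near each of its points $p$ there is a smooth real function $\rho$ with $D=\{\rho<0\}$ near $p$ and $d\rho_p\neq0$), and $\pi|_{\partial D}:\pi^{-1}(S)\cap\partial D\to S$ is a submersion; (ii) for every $y\in S$ the fiber $D_y$ is a smoothly bounded strongly pseudoconvex domain in $\mathbb{C}^n$ (bounded, connected, with smooth boundary whose Levi form is positive definite on the complex tangent space at every boundary point). Suppose moreover that $D$ is pseudoconvex in $\mathbb{C}^{n+1}$, i.e. $D$ admits a continuous plurisubharmonic exhaustion function. Then there exists a defining function $r$ of $D$, i.e. a real function that is smooth on a neighbourhood $U$ of $\overline{D}\cap\pi^{-1}(S)$,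 satisfies $D=\{x\in U\cap\pi^{-1}(S): r(x)<0\}$, and has $dr\neq0$ at every point of $\pi^{-1}(S)\cap\partial D$, such that the real $(1,1)$-form $\omega:=i\partial\bar\partial(-\log(-r))$ on $D$, where $\partial,\bar\partial$ are the operators of $\mathbb{C}^{n+1}$, has the following properties: (a) for every $y\in S$, the restriction $\omega_y:=\omega|_{D_y}$ is a complete Kähler form on $D_y$, i.e. a smooth closed positive $(1,1)$-form whose associated Riemannian distance is complete; (b) $\omega\ge0$ at every point of $D$ and, for every $y\in S$, there is at least one point of $D_y$ at which $\omega$ is strictly positive as a form on $\mathbb{C}^{n+1}$. -/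

import Mathlib

open Set Filter Topology
open scoped ENNReal ContDiff

noncomputable section

/-- The complex Euclidean space `ℂⁿ`. The total space is `ℂⁿ × ℂ`, with projection `Prod.snd`. -/
abbrev Cn (n : ℕ) : Type := EuclideanSpace ℂ (Fin n)

section ComplexForms

variable {E : Type*} [NormedAddCommGroup E] [NormedSpace ℂ E]

/-- Multiplication by `i`, as a real-linear operator. -/
def cJ (E : Type*) [NormedAddCommGroup E] [NormedSpace ℂ E] : E →L[ℝ] E :=
  (Complex.I • ContinuousLinearMap.id ℂ E).restrictScalars ℝ

/-- The real one-form `dᶜf = i(∂̄f - ∂f)`, that is `v ↦ -df(i v)`. -/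
def dc (f : E → ℝ) (p : E) : E [⋀^Fin 1]→L[ℝ] ℝ :=
  ContinuousAlternatingMap.ofSubsingleton ℝ E ℝ (0 : Fin 1) (-((fderiv ℝ f p).comp (cJ E)))

/-- The real `(1,1)`-form `i∂∂̄f = (1/2) d dᶜ f`. -/
def iddbar (f : E → ℝ) (p : E) : E [⋀^Fin 2]→L[ℝ] ℝ :=
  (1 / 2 : ℝ) • extDeriv (dc f) p

/-- The quadratic form `v ↦ τ(v, i v)` of a real two-form. For `τ = i ∑ g_{jk̄} dz_j ∧ dz̄_k` it is
`2 ∑ g_{jk̄} v_j v̄_k`; it is the squared length `g(v, v)` of the metric `g(u, v) = τ(u, i v)`. -/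
def hermSq (τ : E [⋀^Fin 2]→L[ℝ] ℝ) (v : E) : ℝ := τ ![v, Complex.I • v]

/-- `τ ≥ 0` at a point. -/
def FormNonneg (τ : E [⋀^Fin 2]→L[ℝ] ℝ) : Prop := ∀ v, 0 ≤ hermSq τ v

/-- `τ > 0` at a point. -/
def FormPos (τ : E [⋀^Fin 2]→L[ℝ] ℝ) : Prop := ∀ v, v ≠ 0 → 0 < hermSq τ v

/-- `τ` is a Kähler form on the open set `Ω`: a smooth, closed, positive real `(1,1)`-form. -/
structure IsKahlerForm (τ : E → E [⋀^Fin 2]→L[ℝ] ℝ) (Ω : Set E) : Prop where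
  smooth : ContDiffOn ℝ ∞ τ Ω
  closed : ∀ p ∈ Ω, extDeriv τ p = 0
  type11 : ∀ p ∈ Ω, ∀ u v : E, τ p ![Complex.I • u, Complex.I • v] = τ p ![u, v]
  pos : ∀ p ∈ Ω, FormPos (τ p)

/-- The length of a path `γ : [0,1] → E` for the metric `g(u, v) = τ(u, i v)`. -/
def kahlerLength (τ : E → E [⋀^Fin 2]→L[ℝ] ℝ) (γ : ℝ → E) : ℝ≥0∞ :=
  ∫⁻ t in Icc (0 : ℝ) 1, ENNReal.ofReal (Real.sqrt (hermSq (τ (γ t)) (derivWithin γ (Icc 0 1) t)))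

/-- The Riemannian distance in `Ω`: the infimum of the lengths of the `C¹` paths inside `Ω`. -/
def kahlerDist (τ : E → E [⋀^Fin 2]→L[ℝ] ℝ) (Ω : Set E) (x y : E) : ℝ≥0∞ :=
  ⨅ γ ∈ {γ : ℝ → E | ContDiffOn ℝ 1 γ (Icc 0 1) ∧ MapsTo γ (Icc 0 1) Ω ∧ γ 0 = x ∧ γ 1 = y},
    kahlerLength τ γ

/-- `τ` is a complete Kähler form on `Ω`: every Cauchy sequence for its Riemannian distance
converges in `Ω`. -/
def IsCompleteKahlerForm (τ : E → E [⋀^Fin 2]→L[ℝ] ℝ) (Ω : Set E) : Prop :=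
  IsKahlerForm τ Ω ∧
    ∀ u : ℕ → E, (∀ k, u k ∈ Ω) →
      (∀ ε : ℝ≥0∞, 0 < ε → ∃ N, ∀ k ≥ N, ∀ l ≥ N, kahlerDist τ Ω (u k) (u l) < ε) →
      ∃ x ∈ Ω, Tendsto (fun k => kahlerDist τ Ω (u k) x) atTop (𝓝 0)

end ComplexForms

section Pseudoconvexity

variable {E : Type*} [NormedAddCommGroup E] [NormedSpace ℂ E]

/-- A continuous plurisubharmonic function on `D`: the sub-mean value inequality holds on every
closed complex disc `{p + ζ v : |ζ| ≤ 1}` contained in `D`. -/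
def ContinuousPSHOn (φ : E → ℝ) (D : Set E) : Prop :=
  ContinuousOn φ D ∧
    ∀ p v : E, (∀ ζ : ℂ, ‖ζ‖ ≤ 1 → p + ζ • v ∈ D) →
      φ p ≤ Real.circleAverage (fun ζ : ℂ => φ (p + ζ • v)) 0 1

/-- An open set is pseudoconvex if it has a continuous plurisubharmonic exhaustion function. -/
def IsPseudoconvex (D : Set E) : Prop :=
  IsOpen D ∧ ∃ φ : E → ℝ, ContinuousPSHOn φ D ∧ ∀ c : ℝ, IsCompact {x ∈ D | φ x ≤ c}

/-- `ρ` is a smooth local defining function of `D` at the boundary point `p`. -/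
def IsLocalDefiningFunction (ρ : E → ℝ) (D : Set E) (p : E) : Prop :=
  ∃ U : Set E, IsOpen U ∧ p ∈ U ∧ ContDiffOn ℝ ∞ ρ U ∧ (∀ x ∈ U, x ∈ D ↔ ρ x < 0) ∧
    fderiv ℝ ρ p ≠ 0

/-- A smoothly bounded strongly pseudoconvex domain: a bounded domain with smooth boundary whose
Levi form is positive definite on the complex tangent space at each boundary point. -/
def IsBoundedStronglyPseudoconvexDomain (Ω : Set E) : Prop :=
  IsOpen Ω ∧ IsConnected Ω ∧ Bornology.IsBounded Ω ∧
    ∀ p ∈ frontier Ω, ∃ ρ : E → ℝ, IsLocalDefiningFunction ρ Ω p ∧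
      ∀ v : E, v ≠ 0 → fderiv ℝ ρ p v = 0 → fderiv ℝ ρ p (Complex.I • v) = 0 →
        0 < hermSq (iddbar ρ p) v

end Pseudoconvexity

section Families

variable {n : ℕ}

/-- The base `S = π(D)`. -/
def baseSet (D : Set (Cn n × ℂ)) : Set ℂ := Prod.snd '' D

/-- The fiber `D_y`, as a subset of `ℂⁿ`. -/
def fiberSet (D : Set (Cn n × ℂ)) (y : ℂ) : Set (Cn n) := {z | (z, y) ∈ D}

/-- The restriction of a two-form on the total space to the fiber over `y`, that is, its pullback
under `z ↦ (z, y)`. -/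
def fiberForm (τ : Cn n × ℂ → (Cn n × ℂ) [⋀^Fin 2]→L[ℝ] ℝ) (y : ℂ) (z : Cn n) :
    (Cn n) [⋀^Fin 2]→L[ℝ] ℝ :=
  (τ (z, y)).compContinuousLinearMap (ContinuousLinearMap.inl ℝ (Cn n) ℂ)

/-- A holomorphic family of bounded strongly pseudoconvex domains. In `boundary`, the tangent space
of the boundary at `p` is the kernel of `dρ_p`. -/
structure IsHolomorphicFamily (D : Set (Cn n × ℂ)) : Prop where
  isOpen : IsOpen D
  isConnected : IsConnected D
  boundary : ∀ p ∈ frontier D, p.2 ∈ baseSet D →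
    ∃ ρ : Cn n × ℂ → ℝ, IsLocalDefiningFunction ρ D p ∧
      ∀ c : ℂ, ∃ v : Cn n × ℂ, fderiv ℝ ρ p v = 0 ∧ v.2 = c
  fiber : ∀ y ∈ baseSet D, IsBoundedStronglyPseudoconvexDomain (fiberSet D y)

/-- `r` is a (smooth) defining function of the family `D`: it is smooth on a neighbourhood `U` of
the part of the closure of `D` over the base, is negative on `D` and nonnegative on the rest of `U`
over the base, and has non-vanishing differential on the part of the boundary over the base. -/
def IsDefiningFunction (r : Cn n × ℂ → ℝ) (D : Set (Cn n × ℂ)) : Prop :=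
  (∃ U : Set (Cn n × ℂ), IsOpen U ∧ closure D ∩ Prod.snd ⁻¹' baseSet D ⊆ U ∧ ContDiffOn ℝ ∞ r U ∧
    ∀ x ∈ U, x.2 ∈ baseSet D → (x ∈ D ↔ r x < 0)) ∧
  ∀ p ∈ frontier D, p.2 ∈ baseSet D → fderiv ℝ r p ≠ 0

/-- The form `ω = i∂∂̄(-log(-r))` on the total space. -/
def potentialForm (r : Cn n × ℂ → ℝ) : Cn n × ℂ → (Cn n × ℂ) [⋀^Fin 2]→L[ℝ] ℝ :=
  iddbar (fun x => -Real.log (-r x))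

end Families

end

/-! Let `ρ` be a global defining function of `D` over the base `S`, glued from local ones
(`exists_global_defining`). The Levi form of `-log(-ρ)` is the Levi form of `ρ` divided by `|ρ|`,
plus a nonnegative term in `|∂ρ|²/ρ²`. Pseudoconvexity of `D` makes the Levi form of `ρ` nonnegative
on complex tangent vectors at boundary points (`IsPseudoconvex.leviForm_nonneg`). A point `x` of `D`
near the boundary lies within `O(|ρ x|)` of a boundary point, so transporting this inequality to `x`
costs errors that stay bounded after division by `|ρ|`, apart from a cross term absorbed by half of
the `|∂ρ|²/ρ²` term. Hence `-log(-ρ)` has Levi form at least `|∂ρ|²/ρ²`, up to a constant factor,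
minus `C|v|²` (`IsPseudoconvex.exists_leviForm_ge`). The fibers are locally uniformly bounded, so
`C` can be chosen locally uniformly in `y ∈ S`.

It remains to repair the loss `C(y)|v|²`, where `C(y)` may blow up at the edge of `S`. On any open
subset of the plane there are smooth subharmonic functions `A` of arbitrary growth
(`exists_subharmonic_growth`), and `G = exp(A(y) + |y|² + |z|²)` has Levi form at least `2
exp(A)|v|²`. With `r = ρ exp(-G)` one has `-log(-r) = -log(-ρ) + G`, and for `A` large its Levi form
dominates both `|v|²` and a multiple of `|∂ρ|²/ρ²`. The first bound gives positivity on all of `D`.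
Together they give completeness on fibers: the metric controls the flat metric and the differential
of `-log(-ρ)`, which tends to infinity at the boundary. -/

/-! ### Calculus of the Levi form and its relation to `iddbar`. -/

section LeviForm

variable {E : Type*} [NormedAddCommGroup E] [NormedSpace ℂ E]

/-- The Levi form of `f` at `p`, `(1/2) (f''(v, v) + f''(iv, iv))`. -/
noncomputable def leviForm (f : E → ℝ) (p v : E) : ℝ :=
  1 / 2 * (fderiv ℝ (fderiv ℝ f) p v v +
    fderiv ℝ (fderiv ℝ f) p (Complex.I • v) (Complex.I • v))

theorem differentiableAt_fderiv_of_contDiffAt {f : E → ℝ} {p : E} (hf : ContDiffAt ℝ 2 f p) :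
    DifferentiableAt ℝ (fderiv ℝ f) p :=
  (hf.fderiv_right (m := 1) (by norm_num)).differentiableAt (by norm_num)

theorem eventually_differentiableAt_of_contDiffAt {f : E → ℝ} {p : E} (hf : ContDiffAt ℝ 2 f p) :
    ∀ᶠ x in 𝓝 p, DifferentiableAt ℝ f x :=
  (hf.eventually (by norm_num)).mono fun _ hx => hx.differentiableAt (by norm_num)

theorem contDiffAt_dc {f : E → ℝ} {p : E} {m k : ℕ∞ω} (hf : ContDiffAt ℝ k f p)
    (hmk : m + 1 ≤ k) : ContDiffAt ℝ m (dc f) p := by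
  have h1 : ContDiffAt ℝ m (fderiv ℝ f) p := hf.fderiv_right hmk
  have h2 : ContDiffAt ℝ m (fun x => -((fderiv ℝ f x).comp (cJ E))) p :=
    (h1.clm_comp contDiffAt_const).neg
  exact (ContinuousAlternatingMap.ofSubsingletonLIE (𝕜 := ℝ) (E := E) (F := ℝ)
    (i := (0 : Fin 1))).contDiff.contDiffAt.comp p h2

/-- Bridge from forms to Hessians: positivity, type and restriction to fibers are all read off from
this formula. -/
theorem iddbar_apply {f : E → ℝ} {p : E} (hf : ContDiffAt ℝ 2 f p) (u v : E) :
    iddbar f p ![u, v] = 1 / 2 * (fderiv ℝ (fderiv ℝ f) p v (Complex.I • u) -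
      fderiv ℝ (fderiv ℝ f) p u (Complex.I • v)) := by
  have hd : DifferentiableAt ℝ (dc f) p :=
    (contDiffAt_dc (m := 1) hf (by norm_num)).differentiableAt (by norm_num)
  have key : ∀ a b : E, fderiv ℝ (fun x => -(fderiv ℝ f x (Complex.I • a))) p b =
      -(fderiv ℝ (fderiv ℝ f) p b (Complex.I • a)) := by
    intro a b
    have h := (differentiableAt_fderiv_of_contDiffAt hf).hasFDerivAt
    have h2 := (h.clm_apply (hasFDerivAt_const (Complex.I • a) p)).fun_neg
    rw [h2.fderiv]
    simp
  have e : ∀ (i : Fin 2) (x : E), dc f x (i.removeNth ![u, v]) =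
      -(fderiv ℝ f x (Complex.I • (i.removeNth ![u, v] 0))) := fun i x => rfl
  rw [iddbar, ContinuousAlternatingMap.smul_apply, extDeriv_apply hd]
  simp only [e, key]
  simp [Fin.removeNth]
  ring

theorem hermSq_iddbar {f : E → ℝ} {p : E} (hf : ContDiffAt ℝ 2 f p) (v : E) :
    hermSq (iddbar f p) v = leviForm f p v := by
  rw [hermSq, iddbar_apply hf, leviForm, smul_smul, Complex.I_mul_I]
  simp
  ring

theorem iddbar_type11 {f : E → ℝ} {p : E} (hf : ContDiffAt ℝ 2 f p) (u v : E) :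
    iddbar f p ![Complex.I • u, Complex.I • v] = iddbar f p ![u, v] := by
  have hs : IsSymmSndFDerivAt ℝ f p := hf.isSymmSndFDerivAt (by simp)
  rw [iddbar_apply hf, iddbar_apply hf, smul_smul, smul_smul, Complex.I_mul_I,
    hs.eq (Complex.I • v), hs.eq (Complex.I • u)]
  simp
  ring

theorem contDiffAt_iddbar {f : E → ℝ} {p : E} (hf : ContDiffAt ℝ ∞ f p) :
    ContDiffAt ℝ ∞ (iddbar f) p := by
  have h1 : ContDiffAt ℝ ∞ (dc f) p := contDiffAt_dc hf (by rfl)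
  have h2 : ContDiffAt ℝ ∞ (fderiv ℝ (dc f)) p := h1.fderiv_right (by rfl)
  have h3 := (ContinuousAlternatingMap.alternatizeUncurryFinCLM ℝ E ℝ
    (n := 1)).contDiff.contDiffAt.comp p h2
  exact h3.const_smul (1 / 2 : ℝ)

theorem extDeriv_iddbar {f : E → ℝ} {p : E} (hf : ContDiffAt ℝ ∞ f p) :
    extDeriv (iddbar f) p = 0 := by
  have h1 : ContDiffAt ℝ ∞ (dc f) p := contDiffAt_dc hf (by rfl)
  have : iddbar f = (1 / 2 : ℝ) • extDeriv (dc f) := rfl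
  rw [this, extDeriv_smul, extDeriv_extDeriv_apply h1 (by simp; norm_cast)]
  simp

theorem isKahlerForm_iddbar {f : E → ℝ} {Ω : Set E} (hf : ∀ p ∈ Ω, ContDiffAt ℝ ∞ f p)
    (hpos : ∀ p ∈ Ω, ∀ v, v ≠ 0 → 0 < leviForm f p v) : IsKahlerForm (iddbar f) Ω where
  smooth p hp := (contDiffAt_iddbar (hf p hp)).contDiffWithinAt
  closed p hp := extDeriv_iddbar (hf p hp)
  type11 p hp := iddbar_type11 ((hf p hp).of_le (by norm_cast))
  pos p hp v hv := by
    rw [hermSq_iddbar ((hf p hp).of_le (by norm_cast))]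
    exact hpos p hp v hv

theorem leviForm_congr {f g : E → ℝ} {p : E} (h : f =ᶠ[𝓝 p] g) (v : E) :
    leviForm f p v = leviForm g p v := by
  rw [leviForm, leviForm, h.fderiv.fderiv_eq]

theorem leviForm_add {f g : E → ℝ} {p : E} (hf : ContDiffAt ℝ 2 f p) (hg : ContDiffAt ℝ 2 g p)
    (v : E) : leviForm (fun x => f x + g x) p v = leviForm f p v + leviForm g p v := by
  have h : fderiv ℝ (fun x => f x + g x) =ᶠ[𝓝 p] fun x => fderiv ℝ f x + fderiv ℝ g x := by
    filter_upwards [eventually_differentiableAt_of_contDiffAt hf,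
      eventually_differentiableAt_of_contDiffAt hg] with x hx hy
    exact fderiv_add hx hy
  rw [leviForm, leviForm, leviForm, h.fderiv_eq,
    fderiv_fun_add (differentiableAt_fderiv_of_contDiffAt hf)
      (differentiableAt_fderiv_of_contDiffAt hg)]
  simp
  ring

theorem leviForm_const (c : ℝ) (p v : E) : leviForm (fun _ => c) p v = 0 := by
  simp [leviForm]

theorem leviForm_const_mul {f : E → ℝ} {p : E} (hf : ContDiffAt ℝ 2 f p) (c : ℝ) (v : E) :
    leviForm (fun x => c * f x) p v = c * leviForm f p v := by
  have h : fderiv ℝ (fun x => c * f x) =ᶠ[𝓝 p] fun x => c • fderiv ℝ f x := by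
    filter_upwards [eventually_differentiableAt_of_contDiffAt hf] with x hx
    exact fderiv_const_mul hx c
  rw [leviForm, leviForm, h.fderiv_eq,
    fderiv_fun_const_smul (differentiableAt_fderiv_of_contDiffAt hf)]
  simp
  ring

theorem leviForm_sum {ι : Type*} (s : Finset ι) {f : ι → E → ℝ} {p : E}
    (hf : ∀ i ∈ s, ContDiffAt ℝ 2 (f i) p) (v : E) :
    leviForm (fun x => ∑ i ∈ s, f i x) p v = ∑ i ∈ s, leviForm (f i) p v := by
  classical
  induction s using Finset.induction_on with
  | empty => simp [leviForm_const]
  | insert a s ha ih =>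
    simp only [Finset.sum_insert ha]
    rw [leviForm_add (hf a (by simp)) (ContDiffAt.sum fun i hi => hf i (by simp [hi])),
      ih fun i hi => hf i (by simp [hi])]

/-- Chain rule for the Levi form. -/
theorem leviForm_comp {f : E → ℝ} {p : E} {χ : ℝ → ℝ} (hf : ContDiffAt ℝ 2 f p)
    (hχ : ContDiffAt ℝ 2 χ (f p)) (v : E) :
    leviForm (fun x => χ (f x)) p v = deriv χ (f p) * leviForm f p v +
      1 / 2 * deriv (deriv χ) (f p) *
        (fderiv ℝ f p v ^ 2 + fderiv ℝ f p (Complex.I • v) ^ 2) := by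
  have h : fderiv ℝ (fun x => χ (f x)) =ᶠ[𝓝 p] fun x => deriv χ (f x) • fderiv ℝ f x := by
    have h1 : ∀ᶠ y in 𝓝 (f p), DifferentiableAt ℝ χ y :=
      (hχ.eventually (by norm_num)).mono fun _ hx => hx.differentiableAt (by norm_num)
    filter_upwards [eventually_differentiableAt_of_contDiffAt hf,
      hf.continuousAt.eventually h1] with x hx hy
    exact (hy.hasDerivAt.comp_hasFDerivAt x hx.hasFDerivAt).fderiv
  have hχ' : HasDerivAt (deriv χ) (deriv (deriv χ) (f p)) (f p) := by
    have : ContDiffAt ℝ 1 (deriv χ) (f p) := by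
      have h2 : ContDiffAt ℝ 1 (fun y => fderiv ℝ χ y 1) (f p) :=
        (hχ.fderiv_right (m := 1) (by norm_num)).clm_apply contDiffAt_const
      exact h2
    exact (this.differentiableAt (by norm_num)).hasDerivAt
  have hc : HasFDerivAt (fun x => deriv χ (f x)) (deriv (deriv χ) (f p) • fderiv ℝ f p) p :=
    hχ'.comp_hasFDerivAt p (hf.differentiableAt (by norm_num)).hasFDerivAt
  have h2 := hc.fun_smul (differentiableAt_fderiv_of_contDiffAt hf).hasFDerivAt
  rw [leviForm, leviForm, h.fderiv_eq, h2.fderiv]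
  simp
  ring

/-- The Levi form of the squared modulus of a complex affine function. -/
theorem leviForm_normSq (l : E →L[ℂ] ℂ) (c : ℂ) (p v : E) :
    leviForm (fun x => ‖l x - c‖ ^ 2) p v = 2 * ‖l v‖ ^ 2 := by
  let L : E →L[ℝ] ℂ := l.restrictScalars ℝ
  have h1 : ∀ x, HasFDerivAt (fun x => ‖l x - c‖ ^ 2)
      ((2 : ℝ) • (innerSL ℝ (L x - c)).comp L) x := by
    intro x
    have := ((L.hasFDerivAt (x := x)).sub_const c).norm_sq
    refine this.congr_fderiv ?_
    ext v
    simp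
  have h2 : fderiv ℝ (fun x => ‖l x - c‖ ^ 2) = fun x => (2 : ℝ) • (innerSL ℝ (L x - c)).comp L :=
    funext fun x => (h1 x).fderiv
  have h3 : HasFDerivAt (fun x => (2 : ℝ) • (innerSL ℝ (L x - c)).comp L)
      ((2 : ℝ) • (((ContinuousLinearMap.compL ℝ E ℂ ℝ).flip L).comp ((innerSL ℝ).comp L))) p := by
    have h4 : HasFDerivAt (fun x => L x - c) L p := L.hasFDerivAt.sub_const c
    have h5 := ((ContinuousLinearMap.compL ℝ E ℂ ℝ).flip L).hasFDerivAt.comp p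
      ((innerSL ℝ (E := ℂ)).hasFDerivAt.comp p h4)
    exact h5.const_smul (2 : ℝ)
  rw [leviForm, h2, h3.fderiv]
  have e1 : L v = l v := rfl
  have e2 : L (Complex.I • v) = Complex.I * l v := by
    change l (Complex.I • v) = _
    simp
  simp [e1, e2]
  ring

theorem contDiff_normSq_affine (l : E →L[ℂ] ℂ) (c : ℂ) (m : ℕ∞ω) :
    ContDiff ℝ m (fun x => ‖l x - c‖ ^ 2) :=
  (((l.restrictScalars ℝ).contDiff).sub contDiff_const).norm_sq ℝ

/-- The gradient term required by `leviForm_comp` when the squared modulus is composed with `t ↦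
t⁻¹`. -/
theorem fderiv_normSq_affine (l : E →L[ℂ] ℂ) (c : ℂ) (p v : E) :
    fderiv ℝ (fun x => ‖l x - c‖ ^ 2) p v ^ 2 +
      fderiv ℝ (fun x => ‖l x - c‖ ^ 2) p (Complex.I • v) ^ 2 =
      4 * ‖l p - c‖ ^ 2 * ‖l v‖ ^ 2 := by
  let L : E →L[ℝ] ℂ := l.restrictScalars ℝ
  have h1 : HasFDerivAt (fun x => ‖l x - c‖ ^ 2)
      ((2 : ℝ) • (innerSL ℝ (L p - c)).comp L) p := by
    have := ((L.hasFDerivAt (x := p)).sub_const c).norm_sq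
    refine this.congr_fderiv ?_
    ext v
    simp
  have e1 : L v = l v := rfl
  have e2 : L (Complex.I • v) = Complex.I * l v := by
    change l (Complex.I • v) = _
    simp
  rw [h1.fderiv]
  simp only [smul_apply, ContinuousLinearMap.comp_apply, innerSL_apply_apply,
    e1, e2, Complex.inner, Complex.sq_norm, Complex.normSq_apply, smul_eq_mul]
  have e3 : L p = l p := rfl
  rw [e3]
  simp
  ring

/-- The second derivative of the composition with a real affine map. -/
theorem fderiv_fderiv_comp_affine {F : Type*} [NormedAddCommGroup F] [NormedSpace ℂ F]
    {f : E → ℝ} (A : F →L[ℝ] E) (b : E) {z : F} (hf : ContDiffAt ℝ 2 f (A z + b)) (u v : F) :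
    fderiv ℝ (fderiv ℝ (fun z => f (A z + b))) z u v =
      fderiv ℝ (fderiv ℝ f) (A z + b) (A u) (A v) := by
  have hA : ∀ w, HasFDerivAt (fun z => A z + b) A w := fun w => A.hasFDerivAt.add_const b
  have h : fderiv ℝ (fun z => f (A z + b)) =ᶠ[𝓝 z] fun w => (fderiv ℝ f (A w + b)).comp A := by
    have := (hA z).continuousAt.eventually (eventually_differentiableAt_of_contDiffAt hf)
    filter_upwards [this] with w hw
    exact (hw.hasFDerivAt.comp w (hA w)).fderiv
  have h2 : HasFDerivAt (fun w => fderiv ℝ f (A w + b))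
      ((fderiv ℝ (fderiv ℝ f) (A z + b)).comp A) z :=
    (differentiableAt_fderiv_of_contDiffAt hf).hasFDerivAt.comp z (hA z)
  have h3 := ((ContinuousLinearMap.compL ℝ F E ℝ).flip A).hasFDerivAt.comp z h2
  rw [h.fderiv_eq]
  have h4 : HasFDerivAt (fun w => (fderiv ℝ f (A w + b)).comp A)
    (((ContinuousLinearMap.compL ℝ F E ℝ).flip A).comp
      ((fderiv ℝ (fderiv ℝ f) (A z + b)).comp A)) z := h3
  rw [h4.fderiv]
  rfl

theorem leviForm_comp_affine {F : Type*} [NormedAddCommGroup F] [NormedSpace ℂ F]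
    {f : E → ℝ} (A : F →L[ℂ] E) (b : E) {z : F} (hf : ContDiffAt ℝ 2 f (A z + b)) (v : F) :
    leviForm (fun z => f (A z + b)) z v = leviForm f (A z + b) (A v) := by
  have := fderiv_fderiv_comp_affine (A.restrictScalars ℝ) b (z := z) hf
  simp only [ContinuousLinearMap.coe_restrictScalars'] at this
  rw [leviForm, leviForm, this, this]
  simp

end LeviForm

/-! ### Restriction to fibers. -/

section FiberForm

variable {n : ℕ}

/-- The inclusion of a fiber is complex affine, so the Hessian of the restriction is the Hessian of
`f` on vertical vectors. -/
theorem fiberForm_iddbar {f : Cn n × ℂ → ℝ} {z : Cn n} {y : ℂ} (hf : ContDiffAt ℝ 2 f (z, y)) :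
    fiberForm (iddbar f) y z = iddbar (fun w => f (w, y)) z := by
  let A : Cn n →L[ℂ] Cn n × ℂ := ContinuousLinearMap.inl ℂ (Cn n) ℂ
  have hA : ∀ w : Cn n, A w + ((0 : Cn n), y) = (w, y) := fun w => by simp [A]
  have hfz : ContDiffAt ℝ 2 f (A z + ((0 : Cn n), y)) := by rwa [hA]
  have h1 : ContDiffAt ℝ 2 (fun w => f (w, y)) z :=
    hf.comp z (contDiffAt_id.prodMk contDiffAt_const)
  have h2 := fderiv_fderiv_comp_affine (A.restrictScalars ℝ) ((0 : Cn n), y) hfz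
  simp only [ContinuousLinearMap.coe_restrictScalars', hA] at h2
  ext w
  have hw : w = ![w 0, w 1] := by ext i; fin_cases i <;> rfl
  have e : ∀ u v : Cn n, fiberForm (iddbar f) y z ![u, v] = iddbar f (z, y) ![A u, A v] := by
    intro u v
    rw [fiberForm, ContinuousAlternatingMap.compContinuousLinearMap_apply]
    congr 1
    ext i <;> fin_cases i <;> rfl
  rw [hw, e, iddbar_apply hf, iddbar_apply h1, h2, h2]
  simp

end FiberForm

/-! ### Maximum principle on quadratic discs. -/

section MaximumPrinciple

variable {E : Type*} [NormedAddCommGroup E] [NormedSpace ℂ E]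

theorem circleAverage_re_of_differentiable {G : ℂ → ℂ} (hG : Differentiable ℂ G) :
    Real.circleAverage (fun ζ => (G ζ).re) 0 1 = (G 0).re := by
  have h1 : Real.circleAverage G 0 1 = G 0 := hG.diffContOnCl.circleAverage
  have h2 := Complex.reCLM.circleAverage_comp_comm (f := G) (c := 0) (R := 1)
    (hG.continuous.continuousOn.circleIntegrable (by norm_num))
  rw [h1] at h2
  exact h2

theorem normSq_sub_expand (a b : ℂ) :
    ‖a + b‖ ^ 2 = ‖a‖ ^ 2 + ‖b‖ ^ 2 + 2 * (starRingEnd ℂ a * b).re := by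
  rw [Complex.sq_norm, Complex.sq_norm, Complex.sq_norm, Complex.normSq_add]
  congr 2
  simp

/-- The maximum principle for a continuous plurisubharmonic function on a quadratic disc. -/
theorem ContinuousPSHOn.le_of_quadratic_disc {φ : E → ℝ} {D : Set E} (hD : IsOpen D)
    (hφ : ContinuousPSHOn φ D) {p v w : E} {M : ℝ}
    (hmem : ∀ ζ : ℂ, ‖ζ‖ ≤ 1 → p + ζ • v + ζ ^ 2 • w ∈ D)
    (hM : ∀ ζ : ℂ, ‖ζ‖ = 1 → φ (p + ζ • v + ζ ^ 2 • w) ≤ M) : φ p ≤ M := by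
  by_contra! hlt
  obtain ⟨hcont, hmean⟩ := hφ
  -- The gap `φ p - M` is split in three: one part for thickening the rim, one for the perturbation
  -- `η‖ζ‖²`, one to keep the inequality strict.
  set η : ℝ := (φ p - M) / 3 with hη
  have hη0 : 0 < η := by rw [hη]; linarith
  -- The sub-mean value inequality is available only on affine discs. The extra parameter `a`
  -- thickens the quadratic disc so that it contains small affine discs tangent to it.
  let T : ℂ × ℂ → E := fun q => p + q.1 • v + (q.1 ^ 2 + q.2) • w
  have hT : Continuous T := by fun_prop
  have hV : IsOpen (T ⁻¹' D) := hD.preimage hT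
  have hφT : ContinuousOn (fun q => φ (T q)) (T ⁻¹' D) :=
    hcont.comp hT.continuousOn (mapsTo_preimage T D)
  have hU : IsOpen (T ⁻¹' D ∩ (fun q => φ (T q)) ⁻¹' Iio (M + η)) :=
    hφT.isOpen_inter_preimage hV isOpen_Iio
  have hT0 : ∀ ζ : ℂ, T (ζ, 0) = p + ζ • v + ζ ^ 2 • w := fun ζ => by simp [T]
  obtain ⟨δ₁, hδ₁, hsub₁⟩ := ((isCompact_closedBall (0 : ℂ) 1).prod
    (isCompact_singleton (x := (0 : ℂ)))).exists_cthickening_subset_open hV (by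
      rintro ⟨ζ, a⟩ ⟨h1, h2⟩
      obtain rfl : a = 0 := h2
      simpa [hT0] using hmem ζ (by simpa using h1))
  obtain ⟨δ₂, hδ₂, hsub₂⟩ := ((isCompact_sphere (0 : ℂ) 1).prod
    (isCompact_singleton (x := (0 : ℂ)))).exists_cthickening_subset_open hU (by
      rintro ⟨ζ, a⟩ ⟨h1, h2⟩
      obtain rfl : a = 0 := h2
      have h1' : ‖ζ‖ = 1 := by simpa using h1
      refine ⟨by simpa [hT0] using hmem ζ h1'.le, ?_⟩
      have := hM ζ h1'
      simp only [mem_preimage, hT0, mem_Iio]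
      linarith)
  have hthick : ∀ (K : Set ℂ) (δ : ℝ) (ζ a : ℂ), ζ ∈ K → ‖a‖ ≤ δ →
      (ζ, a) ∈ Metric.cthickening δ (K ×ˢ {(0 : ℂ)}) := by
    intro K δ ζ a hζ ha
    refine Metric.mem_cthickening_of_dist_le _ (ζ, (0 : ℂ)) _ _ ⟨hζ, rfl⟩ ?_
    simp [Prod.dist_eq, ha]
  set δ := min δ₁ δ₂ with hδdef
  have hδ : 0 < δ := lt_min hδ₁ hδ₂
  have hin : ∀ ζ a : ℂ, ‖ζ‖ ≤ 1 → ‖a‖ ≤ δ → T (ζ, a) ∈ D := fun ζ a hζ ha =>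
    hsub₁ (hthick _ _ ζ a (by simpa using hζ) (ha.trans (min_le_left _ _)))
  have hbd : ∀ ζ a : ℂ, ‖ζ‖ = 1 → ‖a‖ ≤ δ → φ (T (ζ, a)) < M + η := fun ζ a hζ ha =>
    (hsub₂ (hthick _ _ ζ a (by simpa using hζ) (ha.trans (min_le_right _ _)))).2
  set K : Set (ℂ × ℂ) := Metric.closedBall 0 1 ×ˢ Metric.closedBall 0 δ with hK
  have hKc : IsCompact K := (isCompact_closedBall _ _).prod (isCompact_closedBall _ _)
  have hKV : K ⊆ T ⁻¹' D := by
    rintro ⟨ζ, a⟩ ⟨h1, h2⟩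
    exact hin ζ a (by simpa using h1) (by simpa using h2)
  obtain ⟨B, hB⟩ := (hKc.image_of_continuousOn (hφT.mono hKV)).bddAbove
  have hB' : ∀ ζ a : ℂ, ‖ζ‖ ≤ 1 → ‖a‖ ≤ δ → φ (T (ζ, a)) ≤ B := fun ζ a hζ ha =>
    hB ⟨(ζ, a), ⟨by simpa using hζ, by simpa using ha⟩, rfl⟩
  -- The penalty `A‖a‖²` is so large at `‖a‖ = δ` that the maximum below cannot occur there.
  set A : ℝ := (|B| + |φ p| + η + 1) / δ ^ 2 with hA
  have hAδ : A * δ ^ 2 = |B| + |φ p| + η + 1 := by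
    rw [hA]; field_simp
  have hA0 : 0 < A := by positivity
  obtain ⟨⟨ζ₀, a₀⟩, hmemK, hmax⟩ := hKc.exists_isMaxOn (f := fun q : ℂ × ℂ =>
    φ (T q) - A * ‖q.2‖ ^ 2 + η * ‖q.1‖ ^ 2) ⟨(0, 0), by simp [hK, hδ.le]⟩
    (((hφT.mono hKV).sub (by fun_prop)).add (by fun_prop))
  have hζ₀ : ‖ζ₀‖ ≤ 1 := by simpa using hmemK.1
  have ha₀ : ‖a₀‖ ≤ δ := by simpa using hmemK.2
  have hmax' : ∀ ζ a : ℂ, ‖ζ‖ ≤ 1 → ‖a‖ ≤ δ → φ (T (ζ, a)) - A * ‖a‖ ^ 2 + η * ‖ζ‖ ^ 2 ≤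
      φ (T (ζ₀, a₀)) - A * ‖a₀‖ ^ 2 + η * ‖ζ₀‖ ^ 2 := fun ζ a hζ ha =>
    hmax (show (ζ, a) ∈ K from ⟨by simpa using hζ, by simpa using ha⟩)
  have hge : φ p ≤ φ (T (ζ₀, a₀)) - A * ‖a₀‖ ^ 2 + η * ‖ζ₀‖ ^ 2 := by
    have := hmax' 0 0 (by simp) (by simpa using hδ.le)
    simpa [T] using this
  have hζ1 : ‖ζ₀‖ < 1 := by
    refine lt_of_le_of_ne hζ₀ fun h => ?_
    have h1 := hbd ζ₀ a₀ h ha₀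
    rw [h] at hge
    have : 0 ≤ A * ‖a₀‖ ^ 2 := by positivity
    have : M + 3 * η = φ p := by rw [hη]; ring
    linarith
  have ha1 : ‖a₀‖ < δ := by
    refine lt_of_le_of_ne ha₀ fun h => ?_
    have h1 := hB' ζ₀ a₀ hζ₀ ha₀
    rw [h, hAδ] at hge
    have : η * ‖ζ₀‖ ^ 2 ≤ η * 1 :=
      mul_le_mul_of_nonneg_left (pow_le_one₀ (norm_nonneg _) hζ₀) hη0.le
    have := le_abs_self B
    have := neg_abs_le (φ p)
    linarith
  obtain ⟨r, hr0, hr1, hr2, hr3, hr4⟩ : ∃ r : ℝ, 0 < r ∧ r ≤ 1 ∧ r ≤ 1 - ‖ζ₀‖ ∧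
      r ≤ δ - ‖a₀‖ ∧ A * r < η := by
    refine ⟨min (min 1 (1 - ‖ζ₀‖)) (min (δ - ‖a₀‖) (η / (2 * A))), ?_, ?_, ?_, ?_, ?_⟩
    · refine lt_min (lt_min one_pos (by linarith)) (lt_min (by linarith) (by positivity))
    · exact (min_le_left _ _).trans (min_le_left _ _)
    · exact (min_le_left _ _).trans (min_le_right _ _)
    · exact (min_le_right _ _).trans (min_le_left _ _)
    · calc _ ≤ A * (η / (2 * A)) :=
            mul_le_mul_of_nonneg_left ((min_le_right _ _).trans (min_le_right _ _)) hA0.le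
        _ = η / 2 := by field_simp
        _ < η := by linarith
  set x₀ := T (ζ₀, a₀) with hx₀
  -- Moving `ζ` by `rζ` and `a` by `-r²ζ²` cancels the quadratic term, so the path of `T` is affine
  -- in `ζ`.
  set u : E := (r : ℂ) • (v + (2 * ζ₀) • w) with hu
  have hline : ∀ ζ : ℂ, x₀ + ζ • u = T (ζ₀ + r * ζ, a₀ - r ^ 2 * ζ ^ 2) := by
    intro ζ
    simp only [hx₀, hu, T]
    module
  have hn1 : ∀ ζ : ℂ, ‖ζ‖ ≤ 1 → ‖ζ₀ + r * ζ‖ ≤ 1 := by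
    intro ζ hζ
    refine (norm_add_le _ _).trans ?_
    rw [norm_mul, Complex.norm_real, Real.norm_of_nonneg hr0.le]
    nlinarith
  have hn2 : ∀ ζ : ℂ, ‖ζ‖ ≤ 1 → ‖a₀ - r ^ 2 * ζ ^ 2‖ ≤ δ := by
    intro ζ hζ
    refine (norm_sub_le _ _).trans ?_
    rw [norm_mul, norm_pow, norm_pow, Complex.norm_real, Real.norm_of_nonneg hr0.le]
    have : r ^ 2 * ‖ζ‖ ^ 2 ≤ r * 1 :=
      mul_le_mul (by nlinarith) (pow_le_one₀ (norm_nonneg _) hζ) (by positivity) hr0.le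
    linarith
  have hdisc : ∀ ζ : ℂ, ‖ζ‖ ≤ 1 → x₀ + ζ • u ∈ D := fun ζ hζ => by
    rw [hline]
    exact hin _ _ (hn1 ζ hζ) (hn2 ζ hζ)
  -- By maximality `φ` on the small circle is bounded by a harmonic polynomial whose value at the
  -- centre is `φ x₀ + A r⁴ - η r²`. For `A r < η` and `r ≤ 1` this is less than `φ x₀`, against the
  -- sub-mean value inequality.
  set G : ℂ → ℂ := fun ζ => ((φ x₀ + A * r ^ 4 - η * r ^ 2 : ℝ) : ℂ) +
    ((-2 * A * r ^ 2 : ℝ) : ℂ) * (starRingEnd ℂ a₀ * ζ ^ 2) +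
    ((-2 * η * r : ℝ) : ℂ) * (starRingEnd ℂ ζ₀ * ζ) with hG
  have hGd : Differentiable ℂ G := by fun_prop
  have hle : ∀ ζ ∈ Metric.sphere (0 : ℂ) |1|, φ (x₀ + ζ • u) ≤ (G ζ).re := by
    intro ζ hζ
    have hζ' : ‖ζ‖ = 1 := by simpa using hζ
    have h1 := hmax' _ _ (hn1 ζ hζ'.le) (hn2 ζ hζ'.le)
    rw [← hline] at h1
    have h2 := normSq_sub_expand ζ₀ (r * ζ)
    have h3 := normSq_sub_expand a₀ (-(r ^ 2 * ζ ^ 2))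
    rw [← sub_eq_add_neg] at h3
    have h4 : ‖(r : ℂ) * ζ‖ ^ 2 = r ^ 2 := by simp [hζ']
    have h5 : ‖-((r : ℂ) ^ 2 * ζ ^ 2)‖ ^ 2 = r ^ 4 := by
      rw [norm_neg, norm_mul, norm_pow, norm_pow, hζ', Complex.norm_real,
        Real.norm_of_nonneg hr0.le]
      ring
    have h6 : (starRingEnd ℂ ζ₀ * (r * ζ)).re = r * (starRingEnd ℂ ζ₀ * ζ).re := by
      rw [← Complex.re_ofReal_mul]
      congr 1
      ring
    have h7 : (starRingEnd ℂ a₀ * (-(r ^ 2 * ζ ^ 2))).re =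
        -(r ^ 2 * (starRingEnd ℂ a₀ * ζ ^ 2).re) := by
      rw [← Complex.re_ofReal_mul, ← Complex.neg_re]
      congr 1
      push_cast
      ring
    rw [h2, h3, h4, h5, h6, h7] at h1
    simp only [hG, Complex.add_re, Complex.re_ofReal_mul, Complex.ofReal_re]
    linarith
  have hmv := hmean x₀ u hdisc
  have hci : CircleIntegrable (fun ζ : ℂ => φ (x₀ + ζ • u)) 0 1 := by
    refine ContinuousOn.circleIntegrable (by norm_num) ?_
    refine hcont.comp (by fun_prop) fun ζ hζ => hdisc ζ ?_
    have : ‖ζ‖ = 1 := by simpa using hζ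
    exact this.le
  have hav := Real.circleAverage_mono hci
    ((Complex.continuous_re.comp hGd.continuous).continuousOn.circleIntegrable (by norm_num)) hle
  have hval := circleAverage_re_of_differentiable hGd
  have hG0 : (G 0).re = φ x₀ + A * r ^ 4 - η * r ^ 2 := by
    simp [hG, -Complex.ofReal_pow]
  have : (fun ζ => (G ζ).re) = Complex.re ∘ G := rfl
  rw [this, hG0] at hval
  rw [hval] at hav
  have h8 : A * r ^ 4 < η * r ^ 2 := by
    have : A * r ^ 2 ≤ A * r := mul_le_mul_of_nonneg_left (by nlinarith) hA0.le
    have : A * r ^ 2 * r ^ 2 < η * r ^ 2 :=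
      mul_lt_mul_of_pos_right (by linarith) (by positivity)
    nlinarith
  linarith

end MaximumPrinciple

/-! ### Second order Taylor expansion. -/

section SecondOrderTaylor

variable {E : Type*} [NormedAddCommGroup E] [NormedSpace ℝ E]

/-- The second order Taylor formula with Peano remainder. -/
theorem taylor_two_isLittleO {f : E → ℝ} {p : E} (hf : ContDiffAt ℝ 2 f p) :
    (fun h => f (p + h) - f p - fderiv ℝ f p h - 1 / 2 * fderiv ℝ (fderiv ℝ f) p h h)
      =o[𝓝 0] fun h => ‖h‖ ^ 2 := by
  have hd : HasFDerivAt (fderiv ℝ f) (fderiv ℝ (fderiv ℝ f) p) p :=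
    ((hf.fderiv_right (m := 1) (by norm_num)).differentiableAt (by norm_num)).hasFDerivAt
  have hsymm : IsSymmSndFDerivAt ℝ f p := hf.isSymmSndFDerivAt (by simp)
  have hdiff : ∀ᶠ x in 𝓝 p, DifferentiableAt ℝ f x :=
    (hf.eventually (by norm_num)).mono fun _ hx => hx.differentiableAt (by norm_num)
  set Q := fderiv ℝ (fderiv ℝ f) p with hQ
  rw [Asymptotics.isLittleO_iff]
  intro c hc
  have h1 := (hasFDerivAt_iff_isLittleO_nhds_zero.1 hd).def hc
  have h2 : ∀ᶠ h in 𝓝 (0 : E), DifferentiableAt ℝ f (p + h) := by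
    have : Tendsto (fun h : E => p + h) (𝓝 0) (𝓝 p) := by
      have hc : Continuous fun h : E => p + h := by fun_prop
      simpa using hc.tendsto 0
    exact this.eventually hdiff
  obtain ⟨δ, hδ, hball⟩ := Metric.eventually_nhds_iff.1 (h1.and h2)
  refine Metric.eventually_nhds_iff.2 ⟨δ, hδ, fun h hh => ?_⟩
  -- The derivative of the remainder at `k` is the first order remainder of `fderiv ℝ f`, at most
  -- `c‖k‖`. The mean value inequality on the ball of radius `‖h‖` then gives `c‖h‖²`.
  have hg : ∀ k ∈ Metric.closedBall (0 : E) ‖h‖, HasFDerivWithinAt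
      (fun h => f (p + h) - f p - fderiv ℝ f p h - 1 / 2 * Q h h)
      (fderiv ℝ f (p + k) - fderiv ℝ f p - Q k) (Metric.closedBall 0 ‖h‖) k := by
    intro k hk
    have hk' : dist k 0 < δ := lt_of_le_of_lt (by simpa using hk) (by simpa using hh)
    have e1 : HasFDerivAt (fun h => f (p + h)) (fderiv ℝ f (p + k)) k := by
      exact (hball hk').2.hasFDerivAt.comp k ((hasFDerivAt_id k).const_add p)
    have e2 : HasFDerivAt (fun h => Q h h) _ k :=
      Q.hasFDerivAt.clm_apply (hasFDerivAt_id k)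
    have e3 := ((e1.sub_const (f p)).sub (fderiv ℝ f p).hasFDerivAt).sub
      (e2.const_mul (1 / 2 : ℝ))
    refine (e3.congr_fderiv ?_).hasFDerivWithinAt
    ext v
    have := hsymm.eq k v
    simp only [sub_apply, smul_apply, add_apply, ContinuousLinearMap.comp_apply,
      ContinuousLinearMap.flip_apply, ContinuousLinearMap.id_apply, smul_eq_mul]
    rw [← hQ] at this
    linarith
  have hb : ∀ k ∈ Metric.closedBall (0 : E) ‖h‖,
      ‖fderiv ℝ f (p + k) - fderiv ℝ f p - Q k‖ ≤ c * ‖h‖ := by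
    intro k hk
    have hk1 : ‖k‖ ≤ ‖h‖ := by simpa using hk
    have hk' : dist k 0 < δ := lt_of_le_of_lt (by simpa using hk) (by simpa using hh)
    exact (hball hk').1.trans (mul_le_mul_of_nonneg_left hk1 hc.le)
  have := (convex_closedBall (0 : E) ‖h‖).norm_image_sub_le_of_norm_hasFDerivWithin_le hg hb
    (by simp : (0 : E) ∈ Metric.closedBall 0 ‖h‖) (by simp : h ∈ Metric.closedBall 0 ‖h‖)
  simp only [add_zero, sub_self, map_zero, mul_zero, sub_zero] at this
  calc _ ≤ _ := this
    _ = c * ‖‖h‖ ^ 2‖ := by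
      rw [Real.norm_of_nonneg (by positivity)]
      ring

end SecondOrderTaylor

theorem eq_zero_of_mem_frontier {E : Type*} [TopologicalSpace E] {ρ : E → ℝ} {D : Set E}
    {p : E} (hD : IsOpen D)
    (hρ : ContinuousAt ρ p) (hloc : ∀ᶠ x in 𝓝 p, x ∈ D ↔ ρ x < 0) (hp : p ∈ frontier D) :
    ρ p = 0 := by
  have hpD : p ∉ D := by
    have := hp.2
    rwa [hD.interior_eq] at this
  refine le_antisymm ?_ (not_lt.1 fun h => hpD (hloc.self_of_nhds.2 h))
  by_contra! hpos
  have h1 : ∀ᶠ x in 𝓝 p, x ∉ D := by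
    filter_upwards [hloc, hρ.eventually (lt_mem_nhds hpos)] with x hx hx'
    exact fun h => absurd (hx.1 h) (not_lt.2 hx'.le)
  exact (mem_closure_iff_frequently.1 hp.1) h1

/-! ### The Levi condition at boundary points of a pseudoconvex set. -/

section LeviCondition

variable {E : Type*} [NormedAddCommGroup E] [NormedSpace ℂ E]

/-- The second derivative on a complex line, split into its Levi part and its holomorphic part. -/
theorem fderiv_fderiv_smul_smul {f : E → ℝ} {p : E} (hf : ContDiffAt ℝ 2 f p) (v : E) :
    ∃ β : ℂ, ∀ ζ : ℂ, fderiv ℝ (fderiv ℝ f) p (ζ • v) (ζ • v) =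
      ‖ζ‖ ^ 2 * leviForm f p v + (ζ ^ 2 * β).re := by
  have hsymm : IsSymmSndFDerivAt ℝ f p := hf.isSymmSndFDerivAt (by simp)
  set Q := fderiv ℝ (fderiv ℝ f) p with hQ
  have hs : Q (Complex.I • v) v = Q v (Complex.I • v) := hsymm.eq _ _
  refine ⟨⟨1 / 2 * (Q v v - Q (Complex.I • v) (Complex.I • v)), -Q v (Complex.I • v)⟩, fun ζ => ?_⟩
  have e : ζ • v = ζ.re • v + ζ.im • (Complex.I • v) := by
    conv_lhs => rw [← Complex.re_add_im ζ, add_smul, mul_smul]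
    simp
  rw [e, leviForm, ← hQ, Complex.sq_norm, Complex.normSq_apply]
  simp only [map_add, map_smul, add_apply, smul_apply, smul_eq_mul, hs, pow_two, Complex.mul_re,
    Complex.mul_im]
  ring

/-- A complex tangent direction can be bent into a quadratic disc along which `f` is controlled by
its Levi form. -/
theorem exists_quadratic_disc {f : E → ℝ} {p : E} (hf : ContDiffAt ℝ 2 f p)
    (hp : fderiv ℝ f p ≠ 0) {v : E} (hv : fderiv ℝ f p v = 0)
    (hiv : fderiv ℝ f p (Complex.I • v) = 0) :
    ∃ w : E, (fun ζ : ℂ => f (p + ζ • v + ζ ^ 2 • w) - f p - 1 / 2 * leviForm f p v * ‖ζ‖ ^ 2)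
      =o[𝓝 0] fun ζ => ‖ζ‖ ^ 2 := by
  obtain ⟨β, hβ⟩ := fderiv_fderiv_smul_smul hf v
  -- The bend `w` is chosen so that the first order term of `ζ² w` cancels the harmonic second order
  -- term `(1/2) Re(ζ² β)`. A real functional is the real part of a complex linear one, with
  -- coefficient `α` on the line through `u`, so one equation in `ℂ` suffices.
  obtain ⟨w, hw⟩ : ∃ w : E, ∀ ζ : ℂ, fderiv ℝ f p (ζ • w) = -(1 / 2) * (ζ * β).re := by
    obtain ⟨u, hu⟩ : ∃ u, fderiv ℝ f p u ≠ 0 := by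
      by_contra! h
      exact hp (ContinuousLinearMap.ext h)
    set α : ℂ := ⟨fderiv ℝ f p u, -fderiv ℝ f p (Complex.I • u)⟩ with hα
    have hα0 : α ≠ 0 := fun h => hu (congrArg Complex.re h)
    have hζ : ∀ ζ : ℂ, fderiv ℝ f p (ζ • u) = (ζ * α).re := by
      intro ζ
      have e : ζ • u = ζ.re • u + ζ.im • (Complex.I • u) := by
        conv_lhs => rw [← Complex.re_add_im ζ, add_smul, mul_smul]
        simp
      rw [e]
      simp only [map_add, map_smul, smul_eq_mul, Complex.mul_re, hα]
      ring
    refine ⟨(-(1 / 2) * β / α) • u, fun ζ => ?_⟩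
    rw [smul_smul, hζ, show ζ * (-(1 / 2) * β / α) * α = ((-(1 / 2) : ℝ) : ℂ) * (ζ * β) by
      push_cast; field_simp, Complex.re_ofReal_mul]
  refine ⟨w, ?_⟩
  set Q := fderiv ℝ (fderiv ℝ f) p with hQ
  let h : ℂ → E := fun ζ => ζ • v + ζ ^ 2 • w
  have hcont : Continuous h := by fun_prop
  have hlim : Tendsto h (𝓝 0) (𝓝 0) := by simpa [h] using hcont.tendsto 0
  have hw2 : (fun ζ : ℂ => ζ ^ 2 • w) =o[𝓝 0] fun ζ => ‖ζ‖ := by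
    have : (fun ζ : ℂ => ζ ^ 2) =o[𝓝 0] fun ζ : ℂ => ζ := by
      simpa using Asymptotics.isLittleO_pow_pow (𝕜 := ℂ) (m := 1) (n := 2) (by norm_num)
    have h2 := this.smul_isBigO (Asymptotics.isBigO_refl (fun _ : ℂ => w) (𝓝 0))
    refine h2.trans_isBigO ?_
    refine Asymptotics.IsBigO.of_bound ‖w‖ (Eventually.of_forall fun ζ => ?_)
    simp [norm_smul, mul_comm]
  have hvO : (fun ζ : ℂ => ζ • v) =O[𝓝 0] fun ζ => ‖ζ‖ := by
    refine Asymptotics.IsBigO.of_bound ‖v‖ (Eventually.of_forall fun ζ => ?_)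
    simp [norm_smul, mul_comm]
  have hhO : h =O[𝓝 0] fun ζ => ‖ζ‖ := hvO.add hw2.isBigO
  have h1 : (fun ζ => f (p + h ζ) - f p - fderiv ℝ f p (h ζ) - 1 / 2 * Q (h ζ) (h ζ))
      =o[𝓝 0] fun ζ => ‖ζ‖ ^ 2 := by
    have := (taylor_two_isLittleO hf).comp_tendsto hlim
    exact this.trans_isBigO (hhO.norm_left.pow 2)
  have hQo : ∀ a b : ℂ → E, a =O[𝓝 0] (fun ζ => ‖ζ‖) → b =o[𝓝 0] (fun ζ => ‖ζ‖) →
      (fun ζ => Q (a ζ) (b ζ)) =o[𝓝 0] fun ζ => ‖ζ‖ ^ 2 := by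
    intro a b ha hb
    have e1 : (fun ζ => Q (a ζ) (b ζ)) =O[𝓝 0] fun ζ => ‖a ζ‖ * ‖b ζ‖ := by
      refine Asymptotics.IsBigO.of_bound ‖Q‖ (Eventually.of_forall fun ζ => ?_)
      rw [Real.norm_of_nonneg (mul_nonneg (norm_nonneg (a ζ)) (norm_nonneg (b ζ))), ← mul_assoc]
      exact Q.le_opNorm₂ _ _
    have e2 := ha.norm_left.mul_isLittleO hb.norm_left
    simpa [pow_two] using e1.trans_isLittleO e2
  have hsymm : IsSymmSndFDerivAt ℝ f p := hf.isSymmSndFDerivAt (by simp)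
  have h2 := (hQo _ _ hhO hw2).add (hQo _ _ hvO hw2)
  have h3 := h1.add (h2.const_mul_left (1 / 2 : ℝ))
  refine h3.congr_left fun ζ => ?_
  have e1 := hβ ζ
  have e2 := hw (ζ ^ 2)
  have e3 : fderiv ℝ f p (ζ • v) = 0 := by
    have e : ζ • v = ζ.re • v + ζ.im • (Complex.I • v) := by
      conv_lhs => rw [← Complex.re_add_im ζ, add_smul, mul_smul]
      simp
    rw [e]
    simp [hv, hiv]
  have e4 : Q (ζ ^ 2 • w) (ζ • v) = Q (ζ • v) (ζ ^ 2 • w) := hsymm.eq _ _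
  simp only [h, map_add, add_apply, e3, ← add_assoc] at *
  rw [e1, e2, e4]
  ring

/-- The Levi condition: the Levi form of a defining function of a pseudoconvex open set is
nonnegative on complex tangent vectors. -/
theorem IsPseudoconvex.leviForm_nonneg {ρ : E → ℝ} {D : Set E} {p : E} (hD : IsPseudoconvex D)
    (hρ : ContDiffAt ℝ 2 ρ p) (hloc : ∀ᶠ x in 𝓝 p, x ∈ D ↔ ρ x < 0) (hp : p ∈ frontier D)
    (hdρ : fderiv ℝ ρ p ≠ 0) {v : E} (hv : fderiv ℝ ρ p v = 0)
    (hiv : fderiv ℝ ρ p (Complex.I • v) = 0) : 0 ≤ leviForm ρ p v := by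
  obtain ⟨hDo, φ, hφ, hexh⟩ := hD
  by_contra! hneg
  have hρp := eq_zero_of_mem_frontier hDo hρ.continuousAt hloc hp
  have hpD : p ∉ D := by
    have := hp.2
    rwa [hDo.interior_eq] at this
  set L := leviForm ρ p v with hL
  obtain ⟨w, hw⟩ := exists_quadratic_disc hρ hdρ hv hiv
  obtain ⟨ν, hν⟩ : ∃ ν, fderiv ℝ ρ p ν = -1 := by
    obtain ⟨u, hu⟩ : ∃ u, fderiv ℝ ρ p u ≠ 0 := by
      by_contra! h
      exact hdρ (ContinuousLinearMap.ext h)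
    refine ⟨(-1 / fderiv ℝ ρ p u) • u, ?_⟩
    rw [map_smul, smul_eq_mul]
    field_simp
  have hder : ∀ᶠ x in 𝓝 p, fderiv ℝ ρ x ν < -(1 / 2) := by
    have hc : ContinuousAt (fun x => fderiv ℝ ρ x ν) p :=
      ((hρ.fderiv_right (m := 1) (by norm_num)).continuousAt).clm_apply continuousAt_const
    refine hc.eventually (gt_mem_nhds ?_)
    change fderiv ℝ ρ p ν < _
    rw [hν]
    norm_num
  obtain ⟨δ, hδ, hball⟩ := Metric.eventually_nhds_iff_ball.1
    ((hloc.and (eventually_differentiableAt_of_contDiffAt hρ)).and hder)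
  have hq : Continuous fun s : ℝ × ℂ => p + s.2 • v + s.2 ^ 2 • w + s.1 • ν := by fun_prop
  have hq0 : ∀ᶠ s in 𝓝 (0 : ℝ × ℂ), p + s.2 • v + s.2 ^ 2 • w + s.1 • ν ∈ Metric.ball p δ := by
    refine (hq.tendsto 0).eventually (Metric.isOpen_ball.mem_nhds ?_)
    simpa using hδ
  obtain ⟨κ, hκ, hκball⟩ := Metric.eventually_nhds_iff.1 hq0
  -- A remainder of at most `-L/4 · ‖ζ‖²` still leaves `L/2 - L/4 = L/4 < 0` as the quadratic
  -- coefficient.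
  have hwd := hw.def (c := -L / 4) (by linarith)
  obtain ⟨κ', hκ', hκball'⟩ := Metric.eventually_nhds_iff.1 hwd
  set ε := min κ κ' / 2 with hε
  have hε0 : 0 < ε := by have := lt_min hκ hκ'; rw [hε]; linarith
  have hεκ : ε < κ := by have := min_le_left κ κ'; have := lt_min hκ hκ'; rw [hε]; linarith
  have hεκ' : ε < κ' := by have := min_le_right κ κ'; have := lt_min hκ hκ'; rw [hε]; linarith
  have hmem : ∀ t ∈ Icc (0 : ℝ) ε, ∀ ζ : ℂ, ‖ζ‖ ≤ ε →
      p + ζ • v + ζ ^ 2 • w + t • ν ∈ Metric.ball p δ := by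
    intro t ht ζ hζ
    refine hκball (y := (t, ζ)) ?_
    rw [dist_zero_right, Prod.norm_def, max_lt_iff, Real.norm_of_nonneg ht.1]
    exact ⟨ht.2.trans_lt hεκ, hζ.trans_lt hεκ⟩
  have hest : ∀ t ∈ Icc (0 : ℝ) ε, ∀ ζ : ℂ, ‖ζ‖ ≤ ε →
      ρ (p + ζ • v + ζ ^ 2 • w + t • ν) ≤ L / 4 * ‖ζ‖ ^ 2 - t / 2 := by
    intro t ht ζ hζ
    have h1 := hκball' (y := ζ) (by simpa using hζ.trans_lt hεκ')
    rw [hρp, Real.norm_eq_abs, Real.norm_of_nonneg (by positivity)] at h1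
    have h2 := (abs_le.1 h1).2
    set x := p + ζ • v + ζ ^ 2 • w with hx
    have hd : ∀ s ∈ Icc (0 : ℝ) ε,
        HasDerivAt (fun s : ℝ => ρ (x + s • ν)) (fderiv ℝ ρ (x + s • ν) ν) s := by
      intro s hs
      have h3 : HasDerivAt (fun s : ℝ => x + s • ν) ν s := by
        simpa using ((hasDerivAt_id s).smul_const ν).const_add x
      exact ((hball _ (hmem s hs ζ hζ)).1.2.hasFDerivAt).comp_hasDerivAt s h3
    have h4 := (convex_Icc (0 : ℝ) ε).image_sub_le_mul_sub_of_deriv_le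
      (f := fun s : ℝ => ρ (x + s • ν)) (C := -(1 / 2))
      (fun s hs => (hd s hs).continuousAt.continuousWithinAt)
      (fun s hs => (hd s (interior_subset hs)).differentiableAt.differentiableWithinAt)
      (fun s hs => by
        rw [(hd s (interior_subset hs)).deriv]
        exact (hball _ (hmem s (interior_subset hs) ζ hζ)).2.le)
      0 ⟨le_rfl, hε0.le⟩ t ht ht.1
    simp only [zero_smul, add_zero, sub_zero] at h4
    linarith
  -- The bent disc touches the boundary from inside at `p` only. Its inward translates by `tν`, `t >
  -- 0`, lie wholly in `D`, and the rims lie in `D` even for `t = 0`.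
  have hin : ∀ t ∈ Icc (0 : ℝ) ε, ∀ ζ : ℂ, ‖ζ‖ ≤ ε → (0 < t ∨ ‖ζ‖ = ε) →
      p + ζ • v + ζ ^ 2 • w + t • ν ∈ D := by
    intro t ht ζ hζ hor
    refine (hball _ (hmem t ht ζ hζ)).1.1.2 (lt_of_le_of_lt (hest t ht ζ hζ) ?_)
    have h0 : L / 4 * ‖ζ‖ ^ 2 ≤ 0 := mul_nonpos_of_nonpos_of_nonneg (by linarith) (by positivity)
    rcases hor with h | h
    · linarith
    · have : L / 4 * ‖ζ‖ ^ 2 < 0 := by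
        rw [h]
        exact mul_neg_of_neg_of_pos (by linarith) (by positivity)
      linarith [ht.1]
  -- The rims for all `t ∈ [0, ε]` form a compact subset of `D`, so one bound `M` for the exhaustion
  -- serves them all. The maximum principle passes it to the centres `p + tν`, which therefore stay
  -- in a compact subset of `D` while tending to `p ∉ D`.
  have hKc : IsCompact ((fun s : ℝ × ℂ => p + s.2 • v + s.2 ^ 2 • w + s.1 • ν) ''
      (Icc (0 : ℝ) ε ×ˢ Metric.sphere (0 : ℂ) ε)) :=
    (isCompact_Icc.prod (isCompact_sphere _ _)).image hq
  have hKD : (fun s : ℝ × ℂ => p + s.2 • v + s.2 ^ 2 • w + s.1 • ν) ''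
      (Icc (0 : ℝ) ε ×ˢ Metric.sphere (0 : ℂ) ε) ⊆ D := by
    rintro _ ⟨⟨t, ζ⟩, ⟨ht, hζ⟩, rfl⟩
    have hζ' : ‖ζ‖ = ε := by simpa using hζ
    exact hin t ht ζ hζ'.le (Or.inr hζ')
  obtain ⟨M, hM⟩ := (hKc.image_of_continuousOn (hφ.1.mono hKD)).bddAbove
  have hbound : ∀ t ∈ Ioc (0 : ℝ) ε, p + t • ν ∈ {x ∈ D | φ x ≤ M} := by
    intro t ht
    have ht' : t ∈ Icc (0 : ℝ) ε := ⟨ht.1.le, ht.2⟩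
    have hrw : ∀ ζ : ℂ, p + t • ν + ζ • ((ε : ℂ) • v) + ζ ^ 2 • ((ε ^ 2 : ℂ) • w) =
        p + (ζ * ε) • v + (ζ * ε) ^ 2 • w + t • ν := by
      intro ζ
      rw [smul_smul, smul_smul, mul_pow]
      abel
    have hnorm : ∀ ζ : ℂ, ‖ζ * ε‖ = ‖ζ‖ * ε := by
      intro ζ
      rw [norm_mul, Complex.norm_real, Real.norm_of_nonneg hε0.le]
    refine ⟨?_, ?_⟩
    · simpa using hin t ht' 0 (by simpa using hε0.le) (Or.inl ht.1)
    · refine hφ.le_of_quadratic_disc hDo (v := (ε : ℂ) • v) (w := (ε ^ 2 : ℂ) • w) ?_ ?_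
      · intro ζ hζ
        rw [hrw]
        refine hin t ht' _ ?_ (Or.inl ht.1)
        rw [hnorm]
        nlinarith
      · intro ζ hζ
        rw [hrw]
        refine hM ⟨_, ⟨(t, ζ * ε), ⟨ht', ?_⟩, rfl⟩, rfl⟩
        simp [hζ, abs_of_pos hε0]
  have hlim : Tendsto (fun t : ℝ => p + t • ν) (𝓝[>] 0) (𝓝 p) := by
    have : Continuous fun t : ℝ => p + t • ν := by fun_prop
    simpa using (this.tendsto 0).mono_left nhdsWithin_le_nhds
  have := (hexh M).isClosed.mem_of_tendsto hlim
    (by filter_upwards [Ioc_mem_nhdsGT hε0] with t ht using hbound t ht)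
  exact hpD this.1

end LeviCondition

/-! ### Lower bound for the Levi form of `-log(-ρ)` near the boundary. -/

section BoundaryEstimate

variable {E : Type*} [NormedAddCommGroup E] [NormedSpace ℂ E]

/-- The squared modulus of the complex linear part `2∂f` of the differential of `f`. -/
noncomputable def dNormSq (f : E → ℝ) (p v : E) : ℝ :=
  fderiv ℝ f p v ^ 2 + fderiv ℝ f p (Complex.I • v) ^ 2

theorem dNormSq_nonneg (f : E → ℝ) (p v : E) : 0 ≤ dNormSq f p v := by
  unfold dNormSq
  positivity

theorem clm_complex_smul (l : E →L[ℝ] ℝ) (ζ : ℂ) (v : E) :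
    l (ζ • v) = ζ.re * l v + ζ.im * l (Complex.I • v) := by
  have e : ζ • v = ζ.re • v + ζ.im • (Complex.I • v) := by
    conv_lhs => rw [← Complex.re_add_im ζ, add_smul, mul_smul]
    simp
  rw [e]
  simp

/-- A complex multiple of `ν` corrects `v` to a complex tangent vector. -/
theorem exists_complex_tangent (l : E →L[ℝ] ℝ) {ν : E} (hν : 1 / 2 ≤ l ν) (v : E) :
    ∃ μ : ℂ, l (v - μ • ν) = 0 ∧ l (Complex.I • (v - μ • ν)) = 0 ∧
      ‖μ‖ ≤ 2 * √(l v ^ 2 + l (Complex.I • v) ^ 2) := by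
  set a := l ν with ha
  set b := l (Complex.I • ν) with hb
  set P := l v with hP
  set R := l (Complex.I • v) with hR
  have hab : 1 / 4 ≤ a ^ 2 + b ^ 2 := by nlinarith
  have hab0 : a ^ 2 + b ^ 2 ≠ 0 := by positivity
  -- This is `λ(v)/λ(ν)` for the complex linear functional `λ(u) = l(u) - i l(iu)`, whose kernel is
  -- the complex tangent space.
  refine ⟨⟨(a * P + b * R) / (a ^ 2 + b ^ 2), (b * P - a * R) / (a ^ 2 + b ^ 2)⟩, ?_, ?_, ?_⟩
  · rw [map_sub, clm_complex_smul, ← hP, ← ha, ← hb]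
    field_simp
    ring
  · rw [smul_sub, smul_smul, map_sub, ← hR, clm_complex_smul l _ ν, ← ha, ← hb]
    simp only [Complex.mul_re, Complex.mul_im, Complex.I_re, Complex.I_im]
    field_simp
    ring
  · have h1 : ‖(⟨(a * P + b * R) / (a ^ 2 + b ^ 2), (b * P - a * R) / (a ^ 2 + b ^ 2)⟩ : ℂ)‖ ^ 2 =
        (P ^ 2 + R ^ 2) / (a ^ 2 + b ^ 2) := by
      rw [Complex.sq_norm, Complex.normSq_apply]
      field_simp
      ring
    refine le_of_sq_le_sq ?_ (by positivity)
    rw [h1, mul_pow, Real.sq_sqrt (by positivity), div_le_iff₀ (by positivity)]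
    nlinarith [sq_nonneg P, sq_nonneg R]

/-- Points of `D` near a boundary point are linearly close to the boundary, in terms of `ρ`. -/
theorem exists_frontier_near {ρ : E → ℝ} {D : Set E} {p ν : E}
    (hρ : ContDiffAt ℝ 1 ρ p) (hloc : ∀ᶠ x in 𝓝 p, x ∈ D ↔ ρ x < 0)
    (hν : fderiv ℝ ρ p ν = 1) (hρp : ρ p = 0) {N : Set E} (hN : N ∈ 𝓝 p) :
    ∀ᶠ x in 𝓝 p, x ∈ D → ∃ y ∈ N, y ∈ frontier D ∧ ‖y - x‖ ≤ 2 * ‖ν‖ * |ρ x| := by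
  have hder : ∀ᶠ x in 𝓝 p, 1 / 2 < fderiv ℝ ρ x ν := by
    have hc : ContinuousAt (fun x => fderiv ℝ ρ x ν) p :=
      ((hρ.fderiv_right (m := 0) (by norm_num)).continuousAt).clm_apply continuousAt_const
    refine hc.eventually (lt_mem_nhds ?_)
    change _ < fderiv ℝ ρ p ν
    rw [hν]
    norm_num
  have hdiff : ∀ᶠ x in 𝓝 p, DifferentiableAt ℝ ρ x :=
    (hρ.eventually (by norm_num)).mono fun _ hx => hx.differentiableAt (by norm_num)
  obtain ⟨δ, hδ, hball⟩ := Metric.eventually_nhds_iff_ball.1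
    (((hloc.and hdiff).and hder).and hN)
  have hsmall : ∀ᶠ x in 𝓝 p, ‖x - p‖ + 2 * |ρ x| * ‖ν‖ < δ := by
    have hc : ContinuousAt (fun x => ‖x - p‖ + 2 * |ρ x| * ‖ν‖) p := by
      have := hρ.continuousAt
      fun_prop
    refine hc.eventually (gt_mem_nhds ?_)
    simpa [hρp] using hδ
  filter_upwards [hsmall, hloc] with x hx hxD hxmem
  have hneg := hxD.1 hxmem
  -- Along `ν` the function `ρ` grows at rate at least `1/2`, so it reaches `0` by time `2|ρ x|`.
  set t₀ := 2 * |ρ x| with ht₀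
  have ht₀0 : 0 ≤ t₀ := by positivity
  have hmem : ∀ t ∈ Icc (0 : ℝ) t₀, x + t • ν ∈ Metric.ball p δ := by
    intro t ht
    rw [Metric.mem_ball, dist_eq_norm]
    calc ‖x + t • ν - p‖ = ‖(x - p) + t • ν‖ := by congr 1; abel
      _ ≤ ‖x - p‖ + ‖t • ν‖ := norm_add_le _ _
      _ = ‖x - p‖ + t * ‖ν‖ := by rw [norm_smul, Real.norm_of_nonneg ht.1]
      _ ≤ ‖x - p‖ + t₀ * ‖ν‖ := by gcongr; exact ht.2
      _ < δ := hx
  have hd : ∀ s ∈ Icc (0 : ℝ) t₀,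
      HasDerivAt (fun s : ℝ => ρ (x + s • ν)) (fderiv ℝ ρ (x + s • ν) ν) s := by
    intro s hs
    have h3 : HasDerivAt (fun s : ℝ => x + s • ν) ν s := by
      simpa using ((hasDerivAt_id s).smul_const ν).const_add x
    exact ((hball _ (hmem s hs)).1.1.2.hasFDerivAt).comp_hasDerivAt s h3
  have hgrow : ∀ s ∈ Icc (0 : ℝ) t₀, ∀ t ∈ Icc (0 : ℝ) t₀, s ≤ t →
      1 / 2 * (t - s) ≤ ρ (x + t • ν) - ρ (x + s • ν) :=
    (convex_Icc (0 : ℝ) t₀).mul_sub_le_image_sub_of_le_deriv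
      (f := fun s : ℝ => ρ (x + s • ν))
      (fun s hs => (hd s hs).continuousAt.continuousWithinAt)
      (fun s hs => (hd s (interior_subset hs)).differentiableAt.differentiableWithinAt)
      (fun s hs => by
        rw [(hd s (interior_subset hs)).deriv]
        exact (hball _ (hmem s (interior_subset hs))).1.2.le)
  have h0 : (0 : ℝ) ∈ Icc (0 : ℝ) t₀ := ⟨le_rfl, ht₀0⟩
  have h1 : t₀ ∈ Icc (0 : ℝ) t₀ := ⟨ht₀0, le_rfl⟩
  have hend : 0 ≤ ρ (x + t₀ • ν) := by
    have := hgrow 0 h0 t₀ h1 ht₀0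
    simp only [zero_smul, add_zero, sub_zero, ht₀, abs_of_neg hneg] at this ⊢
    linarith
  obtain ⟨t, ht, htρ⟩ := intermediate_value_Icc ht₀0
    (fun s hs => (hd s hs).continuousAt.continuousWithinAt)
    (show (0 : ℝ) ∈ Icc (ρ (x + (0 : ℝ) • ν)) (ρ (x + t₀ • ν)) from
      ⟨by simpa using hneg.le, hend⟩)
  simp only at htρ
  have ht0 : 0 < t := by
    refine lt_of_le_of_ne ht.1 ?_
    rintro rfl
    simp only [zero_smul, add_zero] at htρ
    exact hneg.ne htρ
  refine ⟨x + t • ν, (hball _ (hmem t ht)).2, ⟨?_, fun h => ?_⟩, ?_⟩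
  · have hc : Continuous fun s : ℝ => x + s • ν := by fun_prop
    refine mem_closure_of_tendsto ((hc.tendsto t).mono_left nhdsWithin_le_nhds :
      Tendsto _ (𝓝[<] t) _) ?_
    filter_upwards [Ico_mem_nhdsLT ht0] with s hs
    have hs' : s ∈ Icc (0 : ℝ) t₀ := ⟨hs.1, hs.2.le.trans ht.2⟩
    have := hgrow s hs' t ht hs.2.le
    exact (hball _ (hmem s hs')).1.1.1.2 (by linarith [hs.2])
  · exact absurd ((hball _ (hmem t ht)).1.1.1.1 (interior_subset h)) (by rw [htρ]; exact lt_irrefl 0)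
  · rw [add_sub_cancel_left, norm_smul, Real.norm_of_nonneg ht.1]
    calc t * ‖ν‖ ≤ t₀ * ‖ν‖ := by gcongr; exact ht.2
      _ = _ := by rw [ht₀]; ring

theorem leviForm_neg_log_neg {ρ : E → ℝ} {x : E} (hρ : ContDiffAt ℝ 2 ρ x) (hx : ρ x < 0) (v : E) :
    leviForm (fun x => -Real.log (-ρ x)) x v =
      leviForm ρ x v / |ρ x| + 1 / 2 * (dNormSq ρ x v / ρ x ^ 2) := by
  have h1 : ∀ t : ℝ, deriv (fun t => -Real.log t) t = -t⁻¹ := fun t => by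
    rw [deriv.fun_neg, Real.deriv_log]
  have h2 : deriv (deriv fun t => -Real.log t) (ρ x) = (ρ x ^ 2)⁻¹ := by
    rw [funext h1, deriv.fun_neg, deriv_inv]
    simp
  have h3 : ContDiffAt ℝ 2 (fun t => -Real.log t) (ρ x) :=
    (Real.contDiffAt_log.2 hx.ne).neg
  -- `Real.log` is even, so the chain rule can be applied with `t ↦ -log t` at the negative value `ρ
  -- x`.
  simp only [Real.log_neg_eq_log]
  rw [leviForm_comp hρ h3 v, h1, h2, abs_of_neg hx, dNormSq]
  field_simp

theorem abs_leviForm_sub_le {f : E → ℝ} {p : E} {M : ℝ}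
    (hM : ‖fderiv ℝ (fderiv ℝ f) p‖ ≤ M) (u v : E) :
    |leviForm f p u - leviForm f p v| ≤ M * ‖u - v‖ * (‖u‖ + ‖v‖) := by
  set Q := fderiv ℝ (fderiv ℝ f) p with hQ
  have key : ∀ a b : E, |Q a a - Q b b| ≤ M * ‖a - b‖ * (‖a‖ + ‖b‖) := by
    intro a b
    have e : Q a a - Q b b = Q (a - b) a + Q b (a - b) := by
      simp only [map_sub, sub_apply]
      ring
    rw [e]
    calc |Q (a - b) a + Q b (a - b)| ≤ ‖Q (a - b) a‖ + ‖Q b (a - b)‖ := abs_add_le _ _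
      _ ≤ ‖Q‖ * ‖a - b‖ * ‖a‖ + ‖Q‖ * ‖b‖ * ‖a - b‖ :=
        add_le_add (Q.le_opNorm₂ _ _) (Q.le_opNorm₂ _ _)
      _ = ‖Q‖ * (‖a - b‖ * (‖a‖ + ‖b‖)) := by ring
      _ ≤ M * (‖a - b‖ * (‖a‖ + ‖b‖)) := by gcongr
      _ = _ := by ring
  have h1 := key u v
  have h2 := key (Complex.I • u) (Complex.I • v)
  rw [← smul_sub, norm_smul, norm_smul, norm_smul, Complex.norm_I, one_mul, one_mul, one_mul] at h2
  rw [abs_le] at *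
  simp only [leviForm, ← hQ]
  constructor <;> linarith [h1.1, h1.2, h2.1, h2.2]

theorem abs_leviForm_sub_le_of_point {f : E → ℝ} {p q : E} {M : ℝ}
    (hM : ‖fderiv ℝ (fderiv ℝ f) p - fderiv ℝ (fderiv ℝ f) q‖ ≤ M) (v : E) :
    |leviForm f p v - leviForm f q v| ≤ M * ‖v‖ ^ 2 := by
  set Q := fderiv ℝ (fderiv ℝ f) p - fderiv ℝ (fderiv ℝ f) q with hQ
  have key : ∀ a : E, |Q a a| ≤ M * ‖a‖ ^ 2 := by
    intro a
    calc |Q a a| ≤ ‖Q‖ * ‖a‖ * ‖a‖ := Q.le_opNorm₂ _ _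
      _ = ‖Q‖ * ‖a‖ ^ 2 := by ring
      _ ≤ M * ‖a‖ ^ 2 := by gcongr
  have h1 := key v
  have h2 := key (Complex.I • v)
  rw [norm_smul, Complex.norm_I, one_mul] at h2
  simp only [hQ, sub_apply] at h1 h2
  rw [abs_le] at *
  simp only [leviForm]
  constructor <;> linarith [h1.1, h1.2, h2.1, h2.2]

theorem abs_leviForm_le {f : E → ℝ} {p : E} {M : ℝ}
    (hM : ‖fderiv ℝ (fderiv ℝ f) p‖ ≤ M) (v : E) : |leviForm f p v| ≤ M * ‖v‖ ^ 2 := by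
  have h0 : leviForm f p 0 = 0 := by simp [leviForm]
  have := abs_leviForm_sub_le hM v 0
  rw [h0, sub_zero, sub_zero, norm_zero, add_zero] at this
  linarith

theorem dNormSq_le {f : E → ℝ} {p : E} {M : ℝ} (hM : ‖fderiv ℝ f p‖ ≤ M) (v : E) :
    √(dNormSq f p v) ≤ 2 * M * ‖v‖ := by
  have hM0 : 0 ≤ M := (norm_nonneg _).trans hM
  have h1 : |fderiv ℝ f p v| ≤ M * ‖v‖ := (fderiv ℝ f p).le_of_opNorm_le hM v
  have h2 : |fderiv ℝ f p (Complex.I • v)| ≤ M * ‖v‖ := by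
    simpa [norm_smul] using (fderiv ℝ f p).le_of_opNorm_le hM (Complex.I • v)
  rw [Real.sqrt_le_iff]
  refine ⟨by positivity, ?_⟩
  have h3 := sq_le_sq' (abs_le.1 h1).1 (abs_le.1 h1).2
  have h4 := sq_le_sq' (abs_le.1 h2).1 (abs_le.1 h2).2
  unfold dNormSq
  nlinarith [sq_nonneg (M * ‖v‖)]

theorem sqrt_dNormSq_le_add {f : E → ℝ} {p q : E} {M : ℝ}
    (hM : ‖fderiv ℝ f p - fderiv ℝ f q‖ ≤ M) (v : E) :
    √(dNormSq f p v) ≤ √(dNormSq f q v) + 2 * M * ‖v‖ := by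
  have hM0 : 0 ≤ M := (norm_nonneg _).trans hM
  have h1 : |(fderiv ℝ f p - fderiv ℝ f q) v| ≤ M * ‖v‖ :=
    (fderiv ℝ f p - fderiv ℝ f q).le_of_opNorm_le hM v
  have h2 : |(fderiv ℝ f p - fderiv ℝ f q) (Complex.I • v)| ≤ M * ‖v‖ := by
    simpa [norm_smul] using (fderiv ℝ f p - fderiv ℝ f q).le_of_opNorm_le hM (Complex.I • v)
  have e : ∀ x, √(dNormSq f x v) = ‖(⟨fderiv ℝ f x v, fderiv ℝ f x (Complex.I • v)⟩ : ℂ)‖ := by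
    intro x
    rw [Complex.norm_def, Complex.normSq_apply, dNormSq]
    congr 1
    ring
  rw [e, e]
  refine (norm_le_norm_add_norm_sub' _
    (⟨fderiv ℝ f q v, fderiv ℝ f q (Complex.I • v)⟩ : ℂ)).trans ?_
  refine add_le_add_right ((Complex.norm_le_abs_re_add_abs_im _).trans ?_) _
  simp only [sub_apply] at h1 h2
  simp only [Complex.sub_re, Complex.sub_im]
  linarith

/-- A lower bound for the Levi form of `-log(-ρ)` at a point `x`, in terms of the Levi condition at
a nearby point `y`. -/
theorem leviForm_neg_log_neg_ge {ρ : E → ℝ} {x y ν : E} {M k A B : ℝ} (hρ : ContDiffAt ℝ 2 ρ x)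
    (hρx : ρ x < 0) (hk : k = ‖ν‖) (hA : A = 2 * M * k * (2 + 4 * M * k))
    (hB : B = A * (4 * M * k) + 2 * M * k) (hν : 1 / 2 ≤ fderiv ℝ ρ y ν)
    (hM₁ : ‖fderiv ℝ ρ y‖ ≤ M) (hM₂ : ‖fderiv ℝ (fderiv ℝ ρ) y‖ ≤ M)
    (hdlip : ‖fderiv ℝ ρ y - fderiv ℝ ρ x‖ ≤ M * (2 * k * |ρ x|))
    (hQlip : ‖fderiv ℝ (fderiv ℝ ρ) x - fderiv ℝ (fderiv ℝ ρ) y‖ ≤ M * (2 * k * |ρ x|))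
    (hy : ∀ u, fderiv ℝ ρ y u = 0 → fderiv ℝ ρ y (Complex.I • u) = 0 → 0 ≤ leviForm ρ y u)
    (v : E) : 1 / 4 * (dNormSq ρ x v / ρ x ^ 2) - (A ^ 2 + B) * ‖v‖ ^ 2 ≤
      leviForm (fun x => -Real.log (-ρ x)) x v := by
  have hM0 : 0 ≤ M := (norm_nonneg _).trans hM₁
  have hk0 : 0 ≤ k := hk ▸ norm_nonneg _
  have hA0 : 0 ≤ A := by rw [hA]; positivity
  rw [leviForm_neg_log_neg hρ hρx]
  set r := |ρ x| with hr
  have hr0 : 0 < r := abs_pos.2 hρx.ne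
  obtain ⟨μ, hμ1, hμ2, hμ3⟩ := exists_complex_tangent (fderiv ℝ ρ y) hν v
  have hlevi := hy _ hμ1 hμ2
  set n := ‖v‖ with hn
  have hn0 : 0 ≤ n := norm_nonneg _
  change _ ≤ 2 * √(dNormSq ρ y v) at hμ3
  have h1 : √(dNormSq ρ y v) ≤ 2 * M * n := dNormSq_le hM₁ v
  have h2 := sqrt_dNormSq_le_add hdlip v
  set N := √(dNormSq ρ x v) with hNdef
  have hNsq : N ^ 2 = dNormSq ρ x v := Real.sq_sqrt (dNormSq_nonneg _ _ _)
  have hN0 : 0 ≤ N := Real.sqrt_nonneg _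
  have h3 := (abs_le.1 (abs_leviForm_sub_le_of_point hQlip v)).1
  have h4 := (abs_le.1 (abs_leviForm_sub_le hM₂ v (v - μ • ν))).1
  have h5 : ‖v - (v - μ • ν)‖ = ‖μ‖ * k := by rw [sub_sub_cancel, norm_smul, hk]
  have h6 : ‖v‖ + ‖v - μ • ν‖ ≤ (2 + 4 * M * k) * n := by
    have := norm_sub_le v (μ • ν)
    rw [norm_smul, ← hk] at this
    have : ‖μ‖ * k ≤ 4 * M * n * k := mul_le_mul_of_nonneg_right (by linarith) hk0
    linarith
  rw [h5] at h4
  -- The normal component of `v` at `y` has size `O(N + r n)`: the `N` part becomes the cross term,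
  -- the `r n` part survives division by `r` as a constant.
  have h7 : M * (‖μ‖ * k) * (‖v‖ + ‖v - μ • ν‖) ≤ A * n * N + A * (4 * M * k) * r * n ^ 2 := by
    calc M * (‖μ‖ * k) * (‖v‖ + ‖v - μ • ν‖)
        ≤ M * ((2 * (N + 2 * (M * (2 * k * r)) * n)) * k) * ((2 + 4 * M * k) * n) := by
          gcongr
          linarith
      _ = A * n * N + A * (4 * M * k) * r * n ^ 2 := by rw [hA]; ring
  have h8 : -(A * n * N) - B * r * n ^ 2 ≤ leviForm ρ x v := by
    have : B * r * n ^ 2 = A * (4 * M * k) * r * n ^ 2 + M * (2 * k * r) * n ^ 2 := by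
      rw [hB]; ring
    linarith
  have h9 : -(A * n * (N / r)) - B * n ^ 2 ≤ leviForm ρ x v / r := by
    rw [le_div_iff₀ hr0]
    calc _ = -(A * n * N) - B * r * n ^ 2 := by field_simp
      _ ≤ _ := h8
  have h10 : dNormSq ρ x v / ρ x ^ 2 = (N / r) ^ 2 := by
    rw [div_pow, hNsq, hr, sq_abs]
  rw [h10]
  -- Completing the square: a quarter of `(N/r)²` absorbs the cross term `A n (N/r)` at the cost of
  -- `A² n²`.
  nlinarith [sq_nonneg (N / r - 2 * A * n)]

/-- Near a boundary point of a pseudoconvex open set, the Levi form of `-log(-ρ)` is bounded below,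
even after removing part of its normal component. -/
theorem IsPseudoconvex.exists_leviForm_ge {ρ : E → ℝ} {D : Set E} {p : E} (hD : IsPseudoconvex D)
    (hρ : ContDiffAt ℝ ∞ ρ p) (hloc : ∀ᶠ x in 𝓝 p, x ∈ D ↔ ρ x < 0) (hp : p ∈ frontier D)
    (hdρ : fderiv ℝ ρ p ≠ 0) :
    ∃ C : ℝ, ∀ᶠ x in 𝓝 p, x ∈ D → ∀ v, 1 / 4 * (dNormSq ρ x v / ρ x ^ 2) - C * ‖v‖ ^ 2 ≤
      leviForm (fun x => -Real.log (-ρ x)) x v := by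
  have hρp := eq_zero_of_mem_frontier hD.1 hρ.continuousAt hloc hp
  obtain ⟨ν, hν⟩ : ∃ ν, fderiv ℝ ρ p ν = 1 := by
    obtain ⟨u, hu⟩ : ∃ u, fderiv ℝ ρ p u ≠ 0 := by
      by_contra! h
      exact hdρ (ContinuousLinearMap.ext h)
    refine ⟨(1 / fderiv ℝ ρ p u) • u, ?_⟩
    rw [map_smul, smul_eq_mul]
    field_simp
  have hd : ContDiffAt ℝ ∞ (fderiv ℝ ρ) p := hρ.fderiv_right (by rfl)
  have hQ : ContDiffAt ℝ ∞ (fderiv ℝ (fderiv ℝ ρ)) p := hd.fderiv_right (by rfl)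
  obtain ⟨K₁, s₁, hs₁, hK₁⟩ := (hd.of_le (by norm_cast) : ContDiffAt ℝ 1 _ p).exists_lipschitzOnWith
  obtain ⟨K₂, s₂, hs₂, hK₂⟩ := (hQ.of_le (by norm_cast) : ContDiffAt ℝ 1 _ p).exists_lipschitzOnWith
  have hder : ∀ᶠ x in 𝓝 p, 1 / 2 < fderiv ℝ ρ x ν := by
    have hc : ContinuousAt (fun x => fderiv ℝ ρ x ν) p :=
      hd.continuousAt.clm_apply continuousAt_const
    refine hc.eventually (lt_mem_nhds ?_)
    change _ < fderiv ℝ ρ p ν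
    rw [hν]
    norm_num
  have hb₁ : ∀ᶠ x in 𝓝 p, ‖fderiv ℝ ρ x‖ < ‖fderiv ℝ ρ p‖ + 1 :=
    hd.continuousAt.norm.eventually (gt_mem_nhds (lt_add_one ‖fderiv ℝ ρ p‖))
  have hb₂ : ∀ᶠ x in 𝓝 p, ‖fderiv ℝ (fderiv ℝ ρ) x‖ < ‖fderiv ℝ (fderiv ℝ ρ) p‖ + 1 :=
    ContinuousAt.norm (f := fderiv ℝ (fderiv ℝ ρ)) hQ.continuousAt |>.eventually (gt_mem_nhds (lt_add_one ‖fderiv ℝ (fderiv ℝ ρ) p‖))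
  set M : ℝ := max (max K₁ K₂) (max (‖fderiv ℝ ρ p‖ + 1) (‖fderiv ℝ (fderiv ℝ ρ) p‖ + 1)) with hM
  have hM1 : (K₁ : ℝ) ≤ M := (le_max_left _ _).trans (le_max_left _ _)
  have hM2 : (K₂ : ℝ) ≤ M := (le_max_right _ _).trans (le_max_left _ _)
  have hM3 : ‖fderiv ℝ ρ p‖ + 1 ≤ M := (le_max_left _ _).trans (le_max_right _ _)
  have hM4 : ‖fderiv ℝ (fderiv ℝ ρ) p‖ + 1 ≤ M := (le_max_right _ _).trans (le_max_right _ _)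
  have hM0 : 0 ≤ M := le_trans (by positivity) hM3
  have hC2 : ∀ᶠ x in 𝓝 p, ContDiffAt ℝ 2 ρ x :=
    (hρ.of_le (by norm_cast) : ContDiffAt ℝ 2 ρ p).eventually (by norm_num)
  have hN := ((((hC2.and hder).and hb₁).and hb₂).and (eventually_eventually_nhds.2 hloc)).and
    (inter_mem hs₁ hs₂ : s₁ ∩ s₂ ∈ 𝓝 p)
  -- The Levi condition is known only on the frontier. The comparison point is within `2‖ν‖|ρ x|` of
  -- `x`, which turns the Lipschitz bounds into errors proportional to `|ρ x|`.
  have hnear := exists_frontier_near (hρ.of_le (by norm_cast)) hloc hν hρp hN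
  set k := ‖ν‖ with hk
  have hk0 : 0 ≤ k := norm_nonneg _
  set A := 2 * M * k * (2 + 4 * M * k) with hA
  set B := A * (4 * M * k) + 2 * M * k with hB
  refine ⟨A ^ 2 + B, ?_⟩
  filter_upwards [hnear, hN, hloc] with x hx hxN hxloc hxD v
  obtain ⟨y, hyN, hyf, hyx⟩ := hx hxD
  have hρx := hxloc.1 hxD
  have hyx' : ‖x - y‖ ≤ 2 * k * |ρ x| := by rwa [norm_sub_rev]
  have hdy : fderiv ℝ ρ y ≠ 0 := by
    intro h
    have := hyN.1.1.1.1.2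
    rw [h] at this
    norm_num at this
  refine leviForm_neg_log_neg_ge hxN.1.1.1.1.1 hρx hk hA hB hyN.1.1.1.1.2.le
    (hyN.1.1.1.2.le.trans hM3) (hyN.1.1.2.le.trans hM4) ?_ ?_ (fun u hu1 hu2 =>
      hD.leviForm_nonneg hyN.1.1.1.1.1 hyN.1.2 hyf hdy hu1 hu2) v
  · rw [norm_sub_rev]
    refine (hK₁.norm_sub_le hxN.2.1 hyN.2.1).trans ?_
    gcongr
  · refine (hK₂.norm_sub_le hxN.2.2 hyN.2.2).trans ?_
    gcongr

end BoundaryEstimate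

/-! ### A smooth convex cutoff. -/

section ConvexCutoff

/-- A smooth convex nondecreasing function vanishing exactly on the nonpositive reals. -/
noncomputable def convexCutoff (t : ℝ) : ℝ := t * expNegInvGlue t

theorem contDiff_convexCutoff : ContDiff ℝ ∞ convexCutoff :=
  contDiff_id.mul expNegInvGlue.contDiff

theorem convexCutoff_of_nonpos {t : ℝ} (ht : t ≤ 0) : convexCutoff t = 0 := by
  rw [convexCutoff, expNegInvGlue.zero_of_nonpos ht, mul_zero]

theorem convexCutoff_pos {t : ℝ} (ht : 0 < t) : 0 < convexCutoff t :=
  mul_pos ht (expNegInvGlue.pos_of_pos ht)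

theorem convexCutoff_nonneg (t : ℝ) : 0 ≤ convexCutoff t := by
  rcases le_or_gt t 0 with h | h
  · exact (convexCutoff_of_nonpos h).ge
  · exact (convexCutoff_pos h).le

theorem deriv_convexCutoff_of_pos {t : ℝ} (ht : 0 < t) :
    deriv convexCutoff t = Real.exp (-t⁻¹) * (1 + t⁻¹) := by
  have h : convexCutoff =ᶠ[𝓝 t] fun s => s * Real.exp (-s⁻¹) := by
    filter_upwards [lt_mem_nhds ht] with s hs
    rw [convexCutoff, expNegInvGlue, if_neg (not_le.2 hs)]
  have h1 : HasDerivAt (fun s : ℝ => s * Real.exp (-s⁻¹)) _ t :=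
    (hasDerivAt_id t).mul ((hasDerivAt_inv ht.ne').neg.exp)
  rw [h.deriv_eq, h1.deriv]
  simp only [id, Pi.neg_apply]
  field_simp

/-- The factor `t` in `convexCutoff` gives convexity on the whole line; `exp(-1/t)` alone has an
inflection point at `t = 1/2`. -/
theorem deriv_deriv_convexCutoff_of_pos {t : ℝ} (ht : 0 < t) :
    deriv (deriv convexCutoff) t = Real.exp (-t⁻¹) * t⁻¹ ^ 3 := by
  have h : deriv convexCutoff =ᶠ[𝓝 t] fun s => Real.exp (-s⁻¹) * (1 + s⁻¹) := by
    filter_upwards [lt_mem_nhds ht] with s hs using deriv_convexCutoff_of_pos hs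
  have h1 : HasDerivAt (fun s : ℝ => Real.exp (-s⁻¹) * (1 + s⁻¹)) _ t :=
    ((hasDerivAt_inv ht.ne').neg.exp).mul ((hasDerivAt_inv ht.ne').const_add 1)
  rw [h.deriv_eq, h1.deriv]
  simp only [Pi.neg_apply]
  field_simp
  ring

theorem deriv_convexCutoff_of_neg {t : ℝ} (ht : t < 0) : deriv convexCutoff t = 0 := by
  have h : convexCutoff =ᶠ[𝓝 t] fun _ => 0 := by
    filter_upwards [gt_mem_nhds ht] with s hs using convexCutoff_of_nonpos hs.le
  rw [h.deriv_eq, deriv_const]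

theorem deriv_deriv_convexCutoff_of_neg {t : ℝ} (ht : t < 0) :
    deriv (deriv convexCutoff) t = 0 := by
  have h : deriv convexCutoff =ᶠ[𝓝 t] fun _ => 0 := by
    filter_upwards [gt_mem_nhds ht] with s hs using deriv_convexCutoff_of_neg hs
  rw [h.deriv_eq, deriv_const]

/-- Makes it unnecessary to compute the derivatives of the cutoff at `0`. -/
theorem nonneg_of_continuous_of_ne_zero {f : ℝ → ℝ} (hf : Continuous f)
    (h : ∀ t, t ≠ 0 → 0 ≤ f t) (t : ℝ) : 0 ≤ f t :=
  (isClosed_le continuous_const hf).closure_subset_iff.2 (fun t ht => h t ht)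
    (dense_compl_singleton (0 : ℝ) t)

theorem deriv_convexCutoff_nonneg (t : ℝ) : 0 ≤ deriv convexCutoff t := by
  refine nonneg_of_continuous_of_ne_zero
    (contDiff_convexCutoff.continuous_deriv (by norm_cast)) (fun t ht => ?_) t
  rcases lt_or_gt_of_ne ht with h | h
  · rw [deriv_convexCutoff_of_neg h]
  · rw [deriv_convexCutoff_of_pos h]
    positivity

theorem deriv_deriv_convexCutoff_nonneg (t : ℝ) : 0 ≤ deriv (deriv convexCutoff) t := by
  have hc : ContDiff ℝ 1 (deriv convexCutoff) := by
    have h2 : ContDiff ℝ (1 + 1) convexCutoff := contDiff_convexCutoff.of_le (by norm_cast)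
    exact (contDiff_succ_iff_deriv.1 h2).2.2
  refine nonneg_of_continuous_of_ne_zero (hc.continuous_deriv le_rfl) (fun t ht => ?_) t
  rcases lt_or_gt_of_ne ht with h | h
  · rw [deriv_deriv_convexCutoff_of_neg h]
  · rw [deriv_deriv_convexCutoff_of_pos h]
    positivity

end ConvexCutoff

/-! ### Smooth subharmonic functions of arbitrary growth on plane open sets. -/

section Subharmonic

/-- `f` is smooth and subharmonic on `S`. -/
structure SmoothSubharmonicOn (f : ℂ → ℝ) (S : Set ℂ) : Prop where
  contDiffAt : ∀ y ∈ S, ContDiffAt ℝ ∞ f y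
  leviForm_nonneg : ∀ y ∈ S, ∀ v, 0 ≤ leviForm f y v

theorem SmoothSubharmonicOn.contDiffAt_two {f : ℂ → ℝ} {S : Set ℂ} (hf : SmoothSubharmonicOn f S)
    {y : ℂ} (hy : y ∈ S) : ContDiffAt ℝ 2 f y :=
  (hf.contDiffAt y hy).of_le (by norm_cast)

theorem smoothSubharmonicOn_const (c : ℝ) (S : Set ℂ) : SmoothSubharmonicOn (fun _ => c) S :=
  ⟨fun _ _ => contDiffAt_const, fun _ _ _ => (leviForm_const c _ _).ge⟩

theorem SmoothSubharmonicOn.add {f g : ℂ → ℝ} {S : Set ℂ} (hf : SmoothSubharmonicOn f S)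
    (hg : SmoothSubharmonicOn g S) : SmoothSubharmonicOn (fun y => f y + g y) S where
  contDiffAt y hy := (hf.contDiffAt y hy).add (hg.contDiffAt y hy)
  leviForm_nonneg y hy v := by
    rw [leviForm_add (hf.contDiffAt_two hy) (hg.contDiffAt_two hy)]
    exact add_nonneg (hf.leviForm_nonneg y hy v) (hg.leviForm_nonneg y hy v)

theorem SmoothSubharmonicOn.sum {ι : Type*} {s : Finset ι} {f : ι → ℂ → ℝ} {S : Set ℂ}
    (hf : ∀ i ∈ s, SmoothSubharmonicOn (f i) S) :
    SmoothSubharmonicOn (fun y => ∑ i ∈ s, f i y) S where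
  contDiffAt y hy := ContDiffAt.sum fun i hi => (hf i hi).contDiffAt y hy
  leviForm_nonneg y hy v := by
    rw [leviForm_sum s fun i hi => (hf i hi).contDiffAt_two hy]
    exact Finset.sum_nonneg fun i hi => (hf i hi).leviForm_nonneg y hy v

theorem SmoothSubharmonicOn.const_mul {f : ℂ → ℝ} {S : Set ℂ} (hf : SmoothSubharmonicOn f S)
    {c : ℝ} (hc : 0 ≤ c) : SmoothSubharmonicOn (fun y => c * f y) S where
  contDiffAt y hy := contDiffAt_const.mul (hf.contDiffAt y hy)
  leviForm_nonneg y hy v := by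
    rw [leviForm_const_mul (hf.contDiffAt_two hy)]
    exact mul_nonneg hc (hf.leviForm_nonneg y hy v)

theorem SmoothSubharmonicOn.convexCutoff_comp {f : ℂ → ℝ} {S : Set ℂ}
    (hf : SmoothSubharmonicOn f S) : SmoothSubharmonicOn (fun y => convexCutoff (f y)) S where
  contDiffAt y hy := contDiff_convexCutoff.contDiffAt.comp y (hf.contDiffAt y hy)
  leviForm_nonneg y hy v := by
    rw [leviForm_comp (hf.contDiffAt_two hy)
      (contDiff_convexCutoff.contDiffAt.of_le (by norm_cast))]
    have h1 := deriv_convexCutoff_nonneg (f y)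
    have h2 := deriv_deriv_convexCutoff_nonneg (f y)
    have h3 := hf.leviForm_nonneg y hy v
    positivity

theorem smoothSubharmonicOn_normSq (S : Set ℂ) : SmoothSubharmonicOn (fun y => ‖y‖ ^ 2) S := by
  have e : (fun y : ℂ => ‖y‖ ^ 2) = fun y => ‖ContinuousLinearMap.id ℂ ℂ y - 0‖ ^ 2 := by simp
  rw [e]
  refine ⟨fun y _ => (contDiff_normSq_affine _ _ _).contDiffAt, fun y _ v => ?_⟩
  rw [leviForm_normSq]
  positivity

/-- This is the squared modulus of `1/(y - a)`, holomorphic on `S`. -/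
theorem smoothSubharmonicOn_inv_normSq {S : Set ℂ} {a : ℂ} (ha : a ∉ S) :
    SmoothSubharmonicOn (fun y => (‖y - a‖ ^ 2)⁻¹) S := by
  have e : (fun y : ℂ => (‖y - a‖ ^ 2)⁻¹) =
      fun y => (‖ContinuousLinearMap.id ℂ ℂ y - a‖ ^ 2)⁻¹ := by simp
  rw [e]
  have hne : ∀ y ∈ S, ‖ContinuousLinearMap.id ℂ ℂ y - a‖ ^ 2 ≠ 0 := by
    intro y hy
    have : y - a ≠ 0 := sub_ne_zero.2 fun h => ha (h ▸ hy)
    simpa using this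
  refine ⟨fun y hy => (contDiff_normSq_affine _ _ _).contDiffAt.inv (hne y hy), fun y hy v => ?_⟩
  have hd2 : ∀ t : ℝ, deriv (deriv fun t : ℝ => t⁻¹) t = 2 * (t ^ 3)⁻¹ := by
    intro t
    have : deriv (fun t : ℝ => t⁻¹) = fun t => -(t ^ (-2 : ℤ)) := by
      ext t
      rw [deriv_inv, zpow_neg]
      norm_cast
    rw [this, deriv.fun_neg, deriv_zpow]
    norm_num
  have h0 := hne y hy
  rw [leviForm_comp (contDiff_normSq_affine _ _ _).contDiffAt
    (contDiffAt_inv ℝ h0), leviForm_normSq, fderiv_normSq_affine, hd2, deriv_inv]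
  set q := ‖ContinuousLinearMap.id ℂ ℂ y - a‖ ^ 2
  have : -(q ^ 2)⁻¹ * (2 * ‖ContinuousLinearMap.id ℂ ℂ v‖ ^ 2) +
      1 / 2 * (2 * (q ^ 3)⁻¹) * (4 * q * ‖ContinuousLinearMap.id ℂ ℂ v‖ ^ 2) =
      2 * (q ^ 2)⁻¹ * ‖ContinuousLinearMap.id ℂ ℂ v‖ ^ 2 := by
    field_simp
    ring
  rw [this]
  positivity

/-- An exhaustion of an open subset of the plane. -/
noncomputable def planeExhaustion (S : Set ℂ) (y : ℂ) : ℝ := max ‖y‖ (Metric.infDist y Sᶜ)⁻¹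

theorem infDist_compl_pos {S : Set ℂ} (hS : IsOpen S) (hne : Sᶜ.Nonempty) {y : ℂ} (hy : y ∈ S) :
    0 < Metric.infDist y Sᶜ :=
  (hS.isClosed_compl.notMem_iff_infDist_pos hne).1 fun h => h hy

theorem continuousAt_planeExhaustion {S : Set ℂ} (hS : IsOpen S) {y : ℂ} (hy : y ∈ S) :
    ContinuousAt (planeExhaustion S) y := by
  refine continuous_norm.continuousAt.max ?_
  -- If `S` is the whole plane, `infDist` to the empty set is `0` and so is its inverse: the
  -- exhaustion is then just `‖y‖`.
  rcases Sᶜ.eq_empty_or_nonempty with h | h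
  · simp only [h, Metric.infDist_empty]
    exact continuousAt_const
  · exact (Metric.continuous_infDist_pt _).continuousAt.inv₀ (infDist_compl_pos hS h hy).ne'

theorem isCompact_planeExhaustion_le {S : Set ℂ} (hS : IsOpen S) (c : ℝ) :
    IsCompact {y ∈ S | planeExhaustion S y ≤ c} := by
  refine Metric.isCompact_of_isClosed_isBounded ?_ ?_
  · rcases Sᶜ.eq_empty_or_nonempty with h | h
    · have hS' : S = univ := compl_empty_iff.1 h
      have : Continuous (planeExhaustion S) :=
        continuous_iff_continuousAt.2 fun y => continuousAt_planeExhaustion hS (hS' ▸ mem_univ y)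
      simpa [hS'] using isClosed_le this continuous_const
    · have : {y ∈ S | planeExhaustion S y ≤ c} =
          {y | ‖y‖ ≤ c} ∩ {y | 1 ≤ c * Metric.infDist y Sᶜ} := by
        ext y
        simp only [planeExhaustion, max_le_iff, mem_ofPred_eq, mem_inter_iff]
        constructor
        · rintro ⟨hy, h1, h2⟩
          exact ⟨h1, (inv_le_iff_one_le_mul₀ (infDist_compl_pos hS h hy)).1 h2⟩
        · rintro ⟨h1, h2⟩
          have hpos : 0 < Metric.infDist y Sᶜ := by
            rcases (Metric.infDist_nonneg (x := y) (s := Sᶜ)).eq_or_lt with h0 | h0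
            · rw [← h0] at h2
              norm_num at h2
            · exact h0
          refine ⟨?_, h1, (inv_le_iff_one_le_mul₀ hpos).2 h2⟩
          by_contra hy
          rw [Metric.infDist_zero_of_mem (show y ∈ Sᶜ from hy)] at hpos
          exact lt_irrefl _ hpos
      rw [this]
      exact (isClosed_le continuous_norm continuous_const).inter
        (isClosed_le continuous_const (continuous_const.mul (Metric.continuous_infDist_pt _)))
  · refine (Metric.isBounded_closedBall (x := (0 : ℂ)) (r := c)).subset fun y hy => ?_
    simpa using (le_max_left _ _).trans hy.2

/-- No approximation theory is needed: `|y|² - k²`, or `|y - a|⁻² - k²` with `a ∉ S` nearest to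
`y₀`, is positive at `y₀` and nonpositive on the sublevel set. The convex cutoff makes it vanish
there and keeps it subharmonic. -/
theorem exists_subharmonic_pos_at {S : Set ℂ} (hS : IsOpen S) {k : ℝ} (hk : 0 ≤ k) {y₀ : ℂ}
    (hlt : k < planeExhaustion S y₀) :
    ∃ f : ℂ → ℝ, SmoothSubharmonicOn f S ∧ (∀ y, 0 ≤ f y) ∧ 0 < f y₀ ∧
      ∀ y ∈ S, planeExhaustion S y ≤ k → f y = 0 := by
  rcases lt_max_iff.1 hlt with h | h
  · refine ⟨fun y => convexCutoff (‖y‖ ^ 2 + -k ^ 2),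
      ((smoothSubharmonicOn_normSq S).add (smoothSubharmonicOn_const _ S)).convexCutoff_comp,
      fun y => convexCutoff_nonneg _, convexCutoff_pos ?_, fun y hy hle => ?_⟩
    · have := pow_lt_pow_left₀ h hk two_ne_zero
      linarith
    · have := pow_le_pow_left₀ (norm_nonneg y) ((le_max_left _ _).trans hle) 2
      exact convexCutoff_of_nonpos (by linarith)
  · have hne : Sᶜ.Nonempty := by
      by_contra hne
      rw [not_nonempty_iff_eq_empty.1 hne, Metric.infDist_empty, inv_zero] at h
      exact absurd hk (not_le.2 h)
    obtain ⟨a, haS, ha⟩ := hS.isClosed_compl.exists_infDist_eq_dist hne y₀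
    refine ⟨fun y => convexCutoff ((‖y - a‖ ^ 2)⁻¹ + -k ^ 2),
      ((smoothSubharmonicOn_inv_normSq haS).add (smoothSubharmonicOn_const _ S)).convexCutoff_comp,
      fun y => convexCutoff_nonneg _, convexCutoff_pos ?_, fun y hy hle => ?_⟩
    · rw [ha, dist_eq_norm] at h
      have := pow_lt_pow_left₀ h hk two_ne_zero
      rw [inv_pow] at this
      linarith
    · have h1 : ‖y - a‖⁻¹ ≤ k := by
        refine le_trans ?_ ((le_max_right _ _).trans hle)
        rw [← dist_eq_norm]
        exact inv_anti₀ (infDist_compl_pos hS hne hy) (Metric.infDist_le_dist_of_mem haS)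
      have := pow_le_pow_left₀ (inv_nonneg.2 (norm_nonneg _)) h1 2
      rw [inv_pow] at this
      exact convexCutoff_of_nonpos (by linarith)

/-- The shell is compact: finitely many functions of the previous kind have a sum bounded below
there by a positive constant, which is then scaled up. -/
theorem exists_subharmonic_ge_on_shell {S : Set ℂ} (hS : IsOpen S) {k : ℝ} (hk : 0 ≤ k) (C : ℝ) :
    ∃ f : ℂ → ℝ, SmoothSubharmonicOn f S ∧ (∀ y, 0 ≤ f y) ∧
      (∀ y ∈ S, k + 1 ≤ planeExhaustion S y → planeExhaustion S y ≤ k + 2 → C ≤ f y) ∧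
      ∀ y ∈ S, planeExhaustion S y ≤ k → f y = 0 := by
  have hKc : IsCompact {y ∈ S | k + 1 ≤ planeExhaustion S y ∧ planeExhaustion S y ≤ k + 2} := by
    have h1 := isCompact_planeExhaustion_le hS (k + 2)
    have h2 : ContinuousOn (planeExhaustion S) {y ∈ S | planeExhaustion S y ≤ k + 2} :=
      fun y hy => (continuousAt_planeExhaustion hS hy.1).continuousWithinAt
    have h3 := h2.preimage_isClosed_of_isClosed h1.isClosed (isClosed_Ici (a := k + 1))
    refine h1.of_isClosed_subset (t := _) (s := _) ?_ (fun y hy => ⟨hy.1, hy.2.2⟩)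
    convert h3 using 1
    ext y
    simp only [mem_ofPred_eq, mem_inter_iff, mem_preimage, mem_Ici]
    tauto
  set K := {y ∈ S | k + 1 ≤ planeExhaustion S y ∧ planeExhaustion S y ≤ k + 2} with hK
  have hex : ∀ y : K, ∃ f : ℂ → ℝ, SmoothSubharmonicOn f S ∧ (∀ y, 0 ≤ f y) ∧ 0 < f y ∧
      ∀ y ∈ S, planeExhaustion S y ≤ k → f y = 0 := fun y =>
    exists_subharmonic_pos_at hS hk (by linarith [y.2.2.1])
  choose f hf1 hf2 hf3 hf4 using hex
  obtain ⟨t, ht⟩ := hKc.elim_nhds_subcover' (fun y hy => {x | 0 < f ⟨y, hy⟩ x}) (fun y hy =>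
    ((hf1 ⟨y, hy⟩).contDiffAt y hy.1).continuousAt.eventually (lt_mem_nhds (hf3 ⟨y, hy⟩)))
  set F : ℂ → ℝ := fun y => ∑ i ∈ t, f i y with hF
  have hFs : SmoothSubharmonicOn F S := SmoothSubharmonicOn.sum fun i _ => hf1 i
  have hF0 : ∀ y, 0 ≤ F y := fun y => Finset.sum_nonneg fun i _ => hf2 i y
  have hFpos : ∀ y ∈ K, 0 < F y := by
    intro y hy
    obtain ⟨i, hi, hiy⟩ := mem_iUnion₂.1 (ht hy)
    exact Finset.sum_pos' (fun j _ => hf2 j y) ⟨i, hi, hiy⟩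
  have hFz : ∀ y ∈ S, planeExhaustion S y ≤ k → F y = 0 := fun y hy hle =>
    Finset.sum_eq_zero fun i _ => hf4 i y hy hle
  have hFc : ContinuousOn F K := fun y hy =>
    (hFs.contDiffAt y hy.1).continuousAt.continuousWithinAt
  obtain ⟨m, hm, hmF⟩ : ∃ m : ℝ, 0 < m ∧ ∀ y ∈ K, m ≤ F y := by
    rcases K.eq_empty_or_nonempty with h | h
    · exact ⟨1, one_pos, fun y hy => absurd hy (h ▸ notMem_empty y)⟩
    · obtain ⟨y, hy, hmin⟩ := hKc.exists_isMinOn h hFc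
      exact ⟨F y, hFpos y hy, fun x hx => hmin hx⟩
  refine ⟨fun y => (|C| / m) * F y, hFs.const_mul (by positivity),
    fun y => mul_nonneg (by positivity) (hF0 y), fun y hy h1 h2 => ?_, fun y hy hle => ?_⟩
  · calc C ≤ |C| := le_abs_self C
      _ = |C| / m * m := by field_simp
      _ ≤ |C| / m * F y := by gcongr; exact hmF y ⟨hy, h1, h2⟩
  · simp only [hFz y hy hle, mul_zero]

/-- On an open subset of the plane there are smooth subharmonic functions of arbitrary growth. -/
theorem exists_subharmonic_growth {S : Set ℂ} (hS : IsOpen S) {P : ℂ → ℝ → Prop}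
    (hmono : ∀ y a b, a ≤ b → P y a → P y b)
    (hloc : ∀ y ∈ S, ∃ C, ∀ᶠ x in 𝓝 y, P x C) :
    ∃ A : ℂ → ℝ, SmoothSubharmonicOn A S ∧ ∀ y ∈ S, P y (A y) := by
  have hcpt : ∀ c : ℝ, ∃ C, 0 ≤ C ∧ ∀ y ∈ S, planeExhaustion S y ≤ c → P y C := by
    intro c
    choose! C hC using hloc
    obtain ⟨t, htS, ht⟩ := (isCompact_planeExhaustion_le hS c).elim_nhds_subcover
      (fun y => {x | P x (C y)}) (fun y hy => hC y hy.1)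
    refine ⟨∑ i ∈ t, |C i|, Finset.sum_nonneg fun i _ => abs_nonneg _, fun y hy hle => ?_⟩
    obtain ⟨i, hi, hiy⟩ := mem_iUnion₂.1 (ht ⟨hy, hle⟩)
    exact hmono _ _ _ ((le_abs_self _).trans
      (Finset.single_le_sum (f := fun i => |C i|) (fun i _ => abs_nonneg _) hi)) hiy
  choose C hC0 hC using hcpt
  choose F hF1 hF2 hF3 hF4 using fun k : ℕ =>
    exists_subharmonic_ge_on_shell hS (Nat.cast_nonneg k) (C (k + 2))
  set s := planeExhaustion S with hs
  -- Since `F k` vanishes where `s ≤ k`, the sum is locally a fixed finite one, and adding further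
  -- terms does not change it.
  let A : ℂ → ℝ := fun y => C 1 + ∑ k ∈ Finset.range ⌈s y⌉₊, F k y
  have hA : ∀ y ∈ S, ∀ N : ℕ, s y ≤ N → A y = C 1 + ∑ k ∈ Finset.range N, F k y := by
    intro y hy N hN
    refine congrArg (C 1 + ·) (Finset.sum_subset ?_ fun k _ hk => hF4 k y hy ?_)
    · exact Finset.range_mono (Nat.ceil_le.2 hN)
    · rw [Finset.mem_range, not_lt] at hk
      exact Nat.ceil_le.1 hk
  have hAloc : ∀ y ∈ S, ∃ N : ℕ, A =ᶠ[𝓝 y] fun x => C 1 + ∑ k ∈ Finset.range N, F k x := by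
    intro y hy
    obtain ⟨N, hN⟩ := exists_nat_gt (s y)
    refine ⟨N, ?_⟩
    filter_upwards [hS.mem_nhds hy,
      (continuousAt_planeExhaustion hS hy).eventually (gt_mem_nhds hN)] with x hx hxN
    exact hA x hx N hxN.le
  have hsum : ∀ N : ℕ, SmoothSubharmonicOn (fun x => C 1 + ∑ k ∈ Finset.range N, F k x) S :=
    fun N => (smoothSubharmonicOn_const _ S).add (SmoothSubharmonicOn.sum fun i _ => hF1 i)
  refine ⟨A, ⟨fun y hy => ?_, fun y hy v => ?_⟩, fun y hy => ?_⟩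
  · obtain ⟨N, hN⟩ := hAloc y hy
    exact ((hsum N).contDiffAt y hy).congr_of_eventuallyEq hN
  · obtain ⟨N, hN⟩ := hAloc y hy
    rw [leviForm_congr hN]
    exact (hsum N).leviForm_nonneg y hy v
  · rcases le_or_gt (s y) 1 with h | h
    · refine hmono _ _ _ ?_ (hC 1 y hy h)
      have : 0 ≤ ∑ k ∈ Finset.range ⌈s y⌉₊, F k y := Finset.sum_nonneg fun k _ => hF2 k y
      simp only [A]
      linarith
    -- Here `k = ⌊s y⌋ - 1`, so `y` lies in the shell on which `F k` is at least `C (k + 2)`.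
    · obtain ⟨k, hk⟩ : ∃ k : ℕ, ⌊s y⌋₊ = k + 1 :=
        Nat.exists_eq_succ_of_ne_zero (Nat.floor_pos.2 h.le).ne'
      have h1 : (k : ℝ) + 1 ≤ s y := by
        have := Nat.floor_le (zero_le_one.trans h.le)
        rw [hk] at this
        exact_mod_cast this
      have h2 : s y ≤ k + 2 := by
        have := (Nat.lt_floor_add_one (s y)).le
        rw [hk] at this
        push_cast at this
        linarith
      refine hmono _ _ _ ?_ (hC (k + 2) y hy h2)
      have h3 := hF3 k y hy h1 h2
      have h4 : k ∈ Finset.range ⌈s y⌉₊ := by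
        rw [Finset.mem_range, Nat.lt_ceil]
        linarith
      have h5 := Finset.single_le_sum (f := fun k => F k y) (fun i _ => hF2 i y) h4
      have h6 := hC0 1
      simp only [A]
      linarith

end Subharmonic

/-! ### A criterion for completeness of the Kähler distance. -/

section Completeness

variable {E : Type*} [NormedAddCommGroup E] [NormedSpace ℂ E]

/-- A function whose differential is bounded by the metric is Lipschitz for the distance. -/
theorem enorm_sub_le_kahlerDist {G : Type*} [NormedAddCommGroup G] [NormedSpace ℝ G]
    [CompleteSpace G]
    {τ : E → E [⋀^Fin 2]→L[ℝ] ℝ} {Ω : Set E} {g : E → G} (hg : ∀ p ∈ Ω, ContDiffAt ℝ 1 g p)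
    {c : ℝ} (hc : 0 < c) (hle : ∀ p ∈ Ω, ∀ v, ‖fderiv ℝ g p v‖ ≤ c * √(hermSq (τ p) v)) (x y : E) :
    ‖g y - g x‖ₑ ≤ ENNReal.ofReal c * kahlerDist τ Ω x y := by
  have hc0 : ENNReal.ofReal c ≠ 0 := (ENNReal.ofReal_pos.2 hc).ne'
  rw [← ENNReal.div_le_iff' hc0 ENNReal.ofReal_ne_top]
  refine le_iInf₂ fun γ hγ => ?_
  obtain ⟨hγ1, hγ2, rfl, rfl⟩ := hγ
  rw [ENNReal.div_le_iff' hc0 ENNReal.ofReal_ne_top]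
  have hgγ : ContDiffOn ℝ 1 (fun t => g (γ t)) (Icc 0 1) := fun t ht =>
    (hg _ (hγ2 ht)).comp_contDiffWithinAt t (hγ1 t ht)
  refine (enorm_sub_le_lintegral_derivWithin_Icc_of_contDiffOn_Icc hgγ zero_le_one).trans ?_
  rw [kahlerLength, ← MeasureTheory.lintegral_const_mul' _ _ ENNReal.ofReal_ne_top]
  refine MeasureTheory.setLIntegral_mono' measurableSet_Icc fun t ht => ?_
  have h1 : HasDerivWithinAt γ (derivWithin γ (Icc 0 1) t) (Icc 0 1) t :=
    ((hγ1.differentiableOn one_ne_zero) t ht).hasDerivWithinAt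
  have h2 := (((hg _ (hγ2 ht)).differentiableAt one_ne_zero).hasFDerivAt).comp_hasDerivWithinAt t h1
  have h3 : derivWithin (fun t => g (γ t)) (Icc 0 1) t =
      fderiv ℝ g (γ t) (derivWithin γ (Icc 0 1) t) :=
    h2.derivWithin (uniqueDiffOn_Icc_zero_one t ht)
  rw [h3, ← ENNReal.ofReal_mul hc.le, ← ofReal_norm]
  exact ENNReal.ofReal_le_ofReal (hle _ (hγ2 ht) _)

/-- Straight segments to `x` stay in a small ball, where the metric is at most `C` times the flat
one. -/
theorem tendsto_kahlerDist {τ : E → E [⋀^Fin 2]→L[ℝ] ℝ} {Ω : Set E} (hΩ : IsOpen Ω) {x : E}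
    (hx : x ∈ Ω) {C : ℝ} (hC : 0 ≤ C)
    (hle : ∀ᶠ p in 𝓝 x, ∀ v, hermSq (τ p) v ≤ C * ‖v‖ ^ 2) {u : ℕ → E}
    (hu : Tendsto u atTop (𝓝 x)) :
    Tendsto (fun k => kahlerDist τ Ω (u k) x) atTop (𝓝 0) := by
  obtain ⟨δ, hδ, hball⟩ := Metric.eventually_nhds_iff_ball.1 (hle.and (hΩ.mem_nhds hx))
  have hbound : ∀ y ∈ Metric.ball x δ,
      kahlerDist τ Ω y x ≤ ENNReal.ofReal (√C * ‖x - y‖) := by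
    intro y hy
    set γ : ℝ → E := fun t => y + t • (x - y) with hγ
    have hγb : ∀ t ∈ Icc (0 : ℝ) 1, γ t ∈ Metric.ball x δ := fun t ht =>
      (convex_ball x δ).add_smul_sub_mem hy (Metric.mem_ball_self hδ) ht
    have hd : ∀ t, HasDerivAt γ (x - y) t := fun t => by
      have := ((hasDerivAt_id t).smul_const (x - y)).const_add y
      rwa [one_smul] at this
    have hγmem : γ ∈ {γ : ℝ → E | ContDiffOn ℝ 1 γ (Icc 0 1) ∧ MapsTo γ (Icc 0 1) Ω ∧
        γ 0 = y ∧ γ 1 = x} :=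
      ⟨ContDiff.contDiffOn (by fun_prop), fun t ht => (hball _ (hγb t ht)).2, by simp [hγ],
        by simp [hγ]⟩
    refine (iInf₂_le γ hγmem).trans ?_
    calc kahlerLength τ γ ≤ ∫⁻ _ in Icc (0 : ℝ) 1, ENNReal.ofReal (√C * ‖x - y‖) := by
          refine MeasureTheory.setLIntegral_mono measurable_const fun t ht => ?_
          refine ENNReal.ofReal_le_ofReal ?_
          rw [(hd t).hasDerivWithinAt.derivWithin (uniqueDiffOn_Icc_zero_one t ht),
            ← Real.sqrt_sq (norm_nonneg (x - y)), ← Real.sqrt_mul hC]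
          exact Real.sqrt_le_sqrt ((hball _ (hγb t ht)).1 _)
      _ = _ := by simp
  have h0 : Tendsto (fun k => ENNReal.ofReal (√C * ‖x - u k‖)) atTop (𝓝 0) := by
    have : Tendsto (fun k => √C * ‖x - u k‖) atTop (𝓝 0) := by
      simpa using ((tendsto_const_nhds (x := x)).sub hu).norm.const_mul (√C)
    simpa using ENNReal.tendsto_ofReal this
  refine tendsto_of_tendsto_of_tendsto_of_le_of_le' tendsto_const_nhds h0
    (Eventually.of_forall fun _ => zero_le) ?_
  filter_upwards [hu.eventually (Metric.ball_mem_nhds x hδ)] with k hk using hbound _ hk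

/-- A criterion for completeness: the metric dominates the flat metric and the differential of a
function that tends to infinity at the boundary. -/
theorem kahler_complete_of_exhaustion [CompleteSpace E] {τ : E → E [⋀^Fin 2]→L[ℝ] ℝ} {Ω : Set E}
    (hΩ : IsOpen Ω) {h : E → ℝ} (hh : ∀ p ∈ Ω, ContDiffAt ℝ 1 h p) {c : ℝ} (hc : 0 < c)
    (hle₁ : ∀ p ∈ Ω, ∀ v, ‖v‖ ≤ c * √(hermSq (τ p) v))
    (hle₂ : ∀ p ∈ Ω, ∀ v, |fderiv ℝ h p v| ≤ c * √(hermSq (τ p) v))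
    (hclosed : ∀ (u : ℕ → E) (x : E) (B : ℝ), (∀ k, u k ∈ Ω) → Tendsto u atTop (𝓝 x) →
      (∀ᶠ k in atTop, h (u k) ≤ B) → x ∈ Ω)
    (hupper : ∀ x ∈ Ω, ∃ C, 0 ≤ C ∧ ∀ᶠ p in 𝓝 x, ∀ v, hermSq (τ p) v ≤ C * ‖v‖ ^ 2)
    (u : ℕ → E) (hu : ∀ k, u k ∈ Ω)
    (hcauchy : ∀ ε : ℝ≥0∞, 0 < ε → ∃ N, ∀ k ≥ N, ∀ l ≥ N, kahlerDist τ Ω (u k) (u l) < ε) :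
    ∃ x ∈ Ω, Tendsto (fun k => kahlerDist τ Ω (u k) x) atTop (𝓝 0) := by
  have hd₁ := enorm_sub_le_kahlerDist (τ := τ) (Ω := Ω) (g := fun x : E => x)
    (fun _ _ => contDiffAt_id) hc (fun p hp v => by simpa using hle₁ p hp v)
  have hd₂ := enorm_sub_le_kahlerDist hh hc hle₂
  have hsmall : ∀ ε : ℝ, 0 < ε → ∃ N, ∀ k ≥ N, ∀ l ≥ N,
      ‖u l - u k‖ < ε ∧ ‖h (u l) - h (u k)‖ < ε := by
    intro ε hε
    obtain ⟨N, hN⟩ := hcauchy (ENNReal.ofReal (ε / (c + 1)))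
      (ENNReal.ofReal_pos.2 (by positivity))
    refine ⟨N, fun k hk l hl => ?_⟩
    have h1 : ENNReal.ofReal c * kahlerDist τ Ω (u k) (u l) < ENNReal.ofReal ε := by
      calc _ ≤ ENNReal.ofReal c * ENNReal.ofReal (ε / (c + 1)) := by
            gcongr
            exact (hN k hk l hl).le
        _ = ENNReal.ofReal (c * (ε / (c + 1))) := (ENNReal.ofReal_mul hc.le).symm
        _ < ENNReal.ofReal ε := by
            rw [ENNReal.ofReal_lt_ofReal_iff hε, mul_div_assoc', div_lt_iff₀ (by positivity)]
            linarith
    have h2 := (hd₁ (u k) (u l)).trans_lt h1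
    have h3 := (hd₂ (u k) (u l)).trans_lt h1
    rw [← ofReal_norm, ENNReal.ofReal_lt_ofReal_iff hε] at h2 h3
    exact ⟨h2, h3⟩
  have hcs : CauchySeq u := by
    refine Metric.cauchySeq_iff.2 fun ε hε => ?_
    obtain ⟨N, hN⟩ := hsmall ε hε
    exact ⟨N, fun k hk l hl => by rw [dist_eq_norm]; exact (hN l hl k hk).1⟩
  obtain ⟨x, hx⟩ := cauchySeq_tendsto_of_complete hcs
  obtain ⟨N, hN⟩ := hsmall 1 one_pos
  -- The Cauchy sequence converges in `E`, and `h` stays bounded along it, so the limit is not a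
  -- boundary point.
  have hxΩ : x ∈ Ω := by
    refine hclosed u x (h (u N) + 1) hu hx ?_
    filter_upwards [eventually_ge_atTop N] with k hk
    have := (abs_lt.1 (hN N le_rfl k hk).2).2
    linarith
  obtain ⟨C, hC0, hC⟩ := hupper x hxΩ
  exact ⟨x, hxΩ, tendsto_kahlerDist hΩ hxΩ hC0 hC hx⟩

end Completeness

/-! ### Signs along a ray from a boundary point. -/

section DirectionalSign

theorem eventually_pos_of_hasDerivAt {h : ℝ → ℝ} {c : ℝ} (hd : HasDerivAt h c 0) (hc : 0 < c)
    (h0 : h 0 = 0) : ∀ᶠ t in 𝓝[>] (0 : ℝ), 0 < h t := by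
  have h1 := (hasDerivAt_iff_tendsto_slope.1 hd).mono_left
    (nhdsWithin_mono 0 (fun t (ht : 0 < t) => ht.ne' : Ioi (0 : ℝ) ⊆ {0}ᶜ))
  filter_upwards [h1.eventually (lt_mem_nhds hc), self_mem_nhdsWithin] with t ht ht0
  rw [slope_def_field, h0, sub_zero, sub_zero] at ht
  exact (div_pos_iff_of_pos_right ht0).1 ht

variable {E : Type*} [NormedAddCommGroup E] [NormedSpace ℝ E]

theorem hasDerivAt_along {f : E → ℝ} {p : E} (hf : DifferentiableAt ℝ f p) (v : E) :
    HasDerivAt (fun t : ℝ => f (p + t • v)) (fderiv ℝ f p v) 0 := by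
  have h1 : HasDerivAt (fun t : ℝ => p + t • v) v 0 := by
    have := ((hasDerivAt_id (0 : ℝ)).smul_const v).const_add p
    rwa [one_smul] at this
  have h2 : HasFDerivAt f (fderiv ℝ f p) (p + (0 : ℝ) • v) := by simpa using hf.hasFDerivAt
  exact h2.comp_hasDerivAt 0 h1

theorem tendsto_along (p v : E) : Tendsto (fun t : ℝ => p + t • v) (𝓝[>] 0) (𝓝 p) := by
  have : Continuous fun t : ℝ => p + t • v := by fun_prop
  simpa using (this.tendsto 0).mono_left nhdsWithin_le_nhds

theorem eventually_mem_of_fderiv_neg {ρ : E → ℝ} {D : Set E} {p v : E}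
    (hρ : DifferentiableAt ℝ ρ p) (hloc : ∀ᶠ x in 𝓝 p, x ∈ D ↔ ρ x < 0) (hρp : ρ p = 0)
    (hv : fderiv ℝ ρ p v < 0) : ∀ᶠ t in 𝓝[>] (0 : ℝ), p + t • v ∈ D := by
  have h1 := eventually_pos_of_hasDerivAt (hasDerivAt_along hρ v).fun_neg (by linarith)
    (by simp [hρp])
  filter_upwards [h1, (tendsto_along p v).eventually hloc] with t ht hD
  exact hD.2 (by linarith)

theorem exists_fderiv_neg {l : E →L[ℝ] ℝ} (hl : l ≠ 0) : ∃ v, l v < 0 := by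
  by_contra! h
  refine hl (ContinuousLinearMap.ext fun v => le_antisymm ?_ (h v))
  simpa using h (-v)

end DirectionalSign

/-! ### Gluing local defining functions. -/

section GlobalDefiningFunction

open scoped Manifold

variable {E : Type*} [NormedAddCommGroup E] [NormedSpace ℝ E]

/-- Away from the frontier the constants `-1` and `1` serve, so every point of `W` has a local piece
with the right sign. -/
theorem exists_local_defining {D W : Set E} (hD : IsOpen D)
    (hloc : ∀ p ∈ frontier D ∩ W, ∃ ρ : E → ℝ, ∃ U : Set E, IsOpen U ∧ p ∈ U ∧
      ContDiffOn ℝ ∞ ρ U ∧ (∀ x ∈ U, x ∈ D ↔ ρ x < 0) ∧ fderiv ℝ ρ p ≠ 0) {p : E} (hp : p ∈ W) :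
    ∃ ρ : E → ℝ, ∃ U : Set E, IsOpen U ∧ p ∈ U ∧ ContDiffOn ℝ ∞ ρ U ∧
      (∀ x ∈ U, x ∈ D ↔ ρ x < 0) ∧ ∀ x ∈ U ∩ frontier D, fderiv ℝ ρ x ≠ 0 := by
  by_cases hpD : p ∈ D
  · refine ⟨fun _ => -1, D, hD, hpD, contDiffOn_const, fun x hx => by simp [hx], fun x hx => ?_⟩
    exact absurd hx.1 (hD.frontier_eq ▸ hx.2).2
  by_cases hpc : p ∈ closure D
  · obtain ⟨ρ, U, hU, hpU, hρ, hsign, hd⟩ := hloc p ⟨⟨hpc, by rwa [hD.interior_eq]⟩, hp⟩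
    have hc : ContinuousOn (fderiv ℝ ρ) U := hρ.continuousOn_fderiv_of_isOpen hU (by norm_cast)
    have hV : IsOpen (U ∩ fderiv ℝ ρ ⁻¹' {0}ᶜ) :=
      hc.isOpen_inter_preimage hU isOpen_compl_singleton
    exact ⟨ρ, _, hV, ⟨hpU, hd⟩, hρ.mono inter_subset_left, fun x hx => hsign x hx.1,
      fun x hx => hx.1.2⟩
  · refine ⟨fun _ => 1, (closure D)ᶜ, isClosed_closure.isOpen_compl, hpc, contDiffOn_const,
      fun x hx => ?_, fun x hx => absurd hx.2.1 hx.1⟩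
    exact ⟨fun h => absurd (subset_closure h) hx, fun h => absurd h (by norm_num)⟩

/-- Local smooth defining functions can be glued to a global one. -/
theorem exists_global_defining [FiniteDimensional ℝ E] {D W : Set E} (hD : IsOpen D) (hW : IsOpen W)
    (hloc : ∀ p ∈ frontier D ∩ W, ∃ ρ : E → ℝ, ∃ U : Set E, IsOpen U ∧ p ∈ U ∧
      ContDiffOn ℝ ∞ ρ U ∧ (∀ x ∈ U, x ∈ D ↔ ρ x < 0) ∧ fderiv ℝ ρ p ≠ 0) :
    ∃ ρ : E → ℝ, (∀ p ∈ W, ContDiffAt ℝ ∞ ρ p) ∧ (∀ x ∈ W, x ∈ D ↔ ρ x < 0) ∧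
      ∀ p ∈ frontier D ∩ W, fderiv ℝ ρ p ≠ 0 := by
  classical
  let M : TopologicalSpace.Opens E := ⟨W, hW⟩
  have hex := fun p : M => exists_local_defining hD hloc p.2
  choose ρ U hU hpU hρ hsign hd using hex
  have : ProperSpace E := FiniteDimensional.proper ℝ E
  have : LocallyCompactSpace M := hW.locallyCompactSpace
  obtain ⟨f, hf⟩ := SmoothPartitionOfUnity.exists_isSubordinate 𝓘(ℝ, E) (isClosed_univ (X := M))
    (fun p => Subtype.val ⁻¹' U p) (fun p => (hU p).preimage continuous_subtype_val)
    (fun p _ => mem_iUnion.2 ⟨p, hpU p⟩)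
  let Φ : M → ℝ := fun x => ∑ᶠ i, f i x • ρ i x
  have hΦ : ContMDiff 𝓘(ℝ, E) 𝓘(ℝ, ℝ) ∞ Φ := by
    refine f.contMDiff_finsum_smul fun i x hx => ?_
    have h1 : ContDiffAt ℝ ∞ (ρ i) x := (hρ i).contDiffAt ((hU i).mem_nhds (hf i hx))
    exact contMDiffAt_subtype_iff.2 h1.contMDiffAt
  have hmemU : ∀ (i : M) (x : M), f i x ≠ 0 → (x : E) ∈ U i := fun i x hx =>
    hf i (subset_tsupport _ hx)
  -- At each point the glued value is a convex combination of local values lying in one half-line,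
  -- so signs are preserved.
  have hneg : ∀ x : M, (x : E) ∈ D → Φ x < 0 := fun x hx =>
    f.finsum_smul_mem_convex (g := fun i (x : M) => ρ i x) (t := Iio 0) (mem_univ x)
      (fun i hi => (hsign i x (hmemU i x hi)).1 hx) (convex_Iio 0)
  have hnonneg : ∀ x : M, (x : E) ∉ D → 0 ≤ Φ x := fun x hx =>
    f.finsum_smul_mem_convex (g := fun i (x : M) => ρ i x) (t := Ici 0) (mem_univ x)
      (fun i hi => not_lt.1 fun h => hx ((hsign i x (hmemU i x hi)).2 h)) (convex_Ici 0)
  -- On `D` all summands are nonpositive, so the sum is at most any one of them. This comparison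
  -- replaces differentiating the sum at the frontier.
  have hterm : ∀ (x : M) (i : M), (x : E) ∈ D → Φ x ≤ f i x * ρ i x := by
    intro x i hx
    have hnp : ∀ j, f j x • ρ j x ≤ 0 := by
      intro j
      by_cases hj : f j x = 0
      · simp [hj]
      · exact mul_nonpos_of_nonneg_of_nonpos (f.nonneg j x)
          ((hsign j x (hmemU j x hj)).1 hx).le
    have hfin : (Function.support fun j => f j x • ρ j x).Finite :=
      (f.locallyFinite.point_finite x).subset fun j hj h => hj (by simp [h])
    have hs := finsum_eq_sum_of_support_subset (s := insert i hfin.toFinset)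
      (fun j => f j x • ρ j x) (by intro j hj; simp; exact Or.inr (by simpa using hj))
    change (∑ᶠ j, f j x • ρ j x) ≤ _
    rw [hs, ← Finset.add_sum_erase _ _ (Finset.mem_insert_self i _)]
    have := Finset.sum_nonpos (s := (insert i hfin.toFinset).erase i)
      (f := fun j => f j x • ρ j x) fun j _ => hnp j
    simp only [smul_eq_mul] at this ⊢
    linarith
  let r : E → ℝ := fun x => if h : x ∈ W then Φ ⟨x, h⟩ else 0
  have hr : ∀ x : M, r x = Φ x := fun x => dif_pos x.2
  have hrs : ∀ p ∈ W, ContDiffAt ℝ ∞ r p := by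
    intro p hp
    have h1 : ContMDiffAt 𝓘(ℝ, E) 𝓘(ℝ, ℝ) ∞ (fun x : M => r x) ⟨p, hp⟩ := by
      simp only [hr]
      exact hΦ.contMDiffAt
    exact (contMDiffAt_subtype_iff.1 h1).contDiffAt
  have hrsign : ∀ x ∈ W, x ∈ D ↔ r x < 0 := by
    intro x hx
    rw [show r x = Φ ⟨x, hx⟩ from hr ⟨x, hx⟩]
    exact ⟨fun h => hneg ⟨x, hx⟩ h, fun h => by_contra fun h' =>
      absurd h (not_lt.2 (hnonneg ⟨x, hx⟩ h'))⟩
  refine ⟨r, hrs, hrsign, fun p hp h0 => ?_⟩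
  have hrp : r p = 0 := eq_zero_of_mem_frontier hD (hrs p hp.2).continuousAt
    (by filter_upwards [hW.mem_nhds hp.2] with x hx using hrsign x hx) hp.1
  let p' : M := ⟨p, hp.2⟩
  obtain ⟨i, hi⟩ : ∃ i, 0 < f i p' := f.exists_pos_of_mem (mem_univ p')
  have hpUi : p ∈ U i := hmemU i p' hi.ne'
  have hρd : ContDiffAt ℝ ∞ (ρ i) p := (hρ i).contDiffAt ((hU i).mem_nhds hpUi)
  have hsigni : ∀ᶠ x in 𝓝 p, x ∈ D ↔ ρ i x < 0 := by
    filter_upwards [(hU i).mem_nhds hpUi] with x hx using hsign i x hx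
  have hρp : ρ i p = 0 := eq_zero_of_mem_frontier hD hρd.continuousAt hsigni hp.1
  obtain ⟨v, hv⟩ := exists_fderiv_neg (hd i p ⟨hpUi, hp.1⟩)
  have hρdiff := hρd.differentiableAt (by simp)
  have hmemD := eventually_mem_of_fderiv_neg hρdiff hsigni hρp hv
  set a := f i p' / 2 with ha
  have ha0 : 0 < a := by positivity
  have hfa : ∀ᶠ x in 𝓝 p, ∀ hx : x ∈ W, a < f i ⟨x, hx⟩ := by
    have h1 : ∀ᶠ x in 𝓝 p', a < f i x :=
      (f i).contMDiff.continuous.continuousAt.eventually (lt_mem_nhds (by rw [ha]; linarith))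
    rw [nhds_subtype_eq_comap, eventually_comap] at h1
    filter_upwards [h1] with x hx hxW using hx ⟨x, hxW⟩ rfl
  -- If `dr` vanished at `p`, then `r - a ρᵢ` would increase in the direction `v`, giving `r > a ρᵢ`
  -- at points of `D` near `p`. But there `r ≤ fᵢ ρᵢ < a ρᵢ`, because `fᵢ > a` and `ρᵢ < 0`.
  have hder := ((hasDerivAt_along ((hrs p hp.2).differentiableAt (by simp)) v).sub
    ((hasDerivAt_along hρdiff v).const_mul a))
  rw [h0] at hder
  have hpos := eventually_pos_of_hasDerivAt hder
    (by simpa using mul_neg_of_pos_of_neg ha0 hv) (by simp [hrp, hρp])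
  obtain ⟨t, ht1, ht2, ht3, ht4, ht5⟩ := (hpos.and (hmemD.and
    (((tendsto_along p v).eventually hfa).and (((tendsto_along p v).eventually
      (hW.mem_nhds hp.2)).and ((tendsto_along p v).eventually hsigni))))).exists
  have h1 := hterm ⟨p + t • v, ht4⟩ i ht2
  rw [← hr] at h1
  have h2 := ht5.1 ht2
  have h3 := mul_lt_mul_of_neg_right (ht3 ht4) h2
  simp only [Pi.sub_apply] at ht1
  linarith

end GlobalDefiningFunction

/-! ### The estimate at interior points. -/

section InteriorEstimate

variable {E : Type*} [NormedAddCommGroup E] [NormedSpace ℂ E]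

/-- Away from the boundary `|ρ|` is bounded below, so the Levi form of `ρ` divided by `|ρ|` is
bounded. -/
theorem exists_leviForm_neg_log_neg_ge_of_neg {ρ : E → ℝ} {p : E} (hρ : ContDiffAt ℝ ∞ ρ p)
    (hneg : ρ p < 0) :
    ∃ C : ℝ, ∀ᶠ x in 𝓝 p, ∀ v, 1 / 4 * (dNormSq ρ x v / ρ x ^ 2) - C * ‖v‖ ^ 2 ≤
      leviForm (fun x => -Real.log (-ρ x)) x v := by
  have hQ : ContDiffAt ℝ ∞ (fderiv ℝ (fderiv ℝ ρ)) p :=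
    (hρ.fderiv_right (m := ∞) (by rfl)).fderiv_right (by rfl)
  set M := ‖fderiv ℝ (fderiv ℝ ρ) p‖ + 1 with hM
  have hb : ∀ᶠ x in 𝓝 p, ‖fderiv ℝ (fderiv ℝ ρ) x‖ < M :=
    ContinuousAt.norm (f := fderiv ℝ (fderiv ℝ ρ)) hQ.continuousAt |>.eventually
      (gt_mem_nhds (lt_add_one ‖fderiv ℝ (fderiv ℝ ρ) p‖))
  have hC2 : ∀ᶠ x in 𝓝 p, ContDiffAt ℝ 2 ρ x :=
    (hρ.of_le (by norm_cast) : ContDiffAt ℝ 2 ρ p).eventually (by norm_num)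
  have hlt : ∀ᶠ x in 𝓝 p, ρ x < ρ p / 2 :=
    hρ.continuousAt.eventually (gt_mem_nhds (by linarith))
  refine ⟨M / (-ρ p / 2), ?_⟩
  filter_upwards [hb, hC2, hlt] with x hx1 hx2 hx3 v
  have hρx : ρ x < 0 := by linarith
  rw [leviForm_neg_log_neg hx2 hρx]
  have h1 := (abs_le.1 (abs_leviForm_le hx1.le v)).1
  have h2 : -(M / (-ρ p / 2)) * ‖v‖ ^ 2 ≤ leviForm ρ x v / |ρ x| := by
    rw [abs_of_neg hρx, le_div_iff₀ (by linarith)]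
    have : M * ‖v‖ ^ 2 * (-ρ p / 2) ≤ M * ‖v‖ ^ 2 * -ρ x :=
      mul_le_mul_of_nonneg_left (by linarith) (by positivity)
    have h3 : M * ‖v‖ ^ 2 ≤ M / (-ρ p / 2) * ‖v‖ ^ 2 * -ρ x := by
      rw [div_mul_eq_mul_div, div_mul_eq_mul_div, le_div_iff₀ (by linarith)]
      exact this
    linarith
  have h3 : 0 ≤ dNormSq ρ x v / ρ x ^ 2 := div_nonneg (dNormSq_nonneg _ _ _) (sq_nonneg _)
  linarith

theorem IsKahlerForm.congr {τ τ' : E → E [⋀^Fin 2]→L[ℝ] ℝ} {Ω : Set E} (hΩ : IsOpen Ω)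
    (h : IsKahlerForm τ Ω) (heq : EqOn τ' τ Ω) : IsKahlerForm τ' Ω where
  smooth := h.smooth.congr heq
  closed p hp := by
    rw [(heq.eventuallyEq_of_mem (hΩ.mem_nhds hp)).extDeriv_eq]
    exact h.closed p hp
  type11 p hp := by
    rw [heq hp]
    exact h.type11 p hp
  pos p hp := by
    rw [heq hp]
    exact h.pos p hp

end InteriorEstimate

/-! ### Uniform estimates over the base, the exponential weight, and completeness of the fibers. -/

section Families

variable {n : ℕ} {D : Set (Cn n × ℂ)}

theorem isOpen_fiberSet (hD : IsOpen D) (y : ℂ) : IsOpen (fiberSet D y) :=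
  hD.preimage (continuous_id.prodMk continuous_const)

theorem isOpen_baseSet (hD : IsOpen D) : IsOpen (baseSet D) := isOpenMap_snd D hD

/-- Submersivity allows an inward direction to be corrected by a boundary tangent vector so that it
becomes vertical; moving along it stays in the fiber and enters `D`. -/
theorem IsHolomorphicFamily.mem_closure_fiberSet (hfam : IsHolomorphicFamily D) {z : Cn n} {y : ℂ}
    (hp : (z, y) ∈ frontier D) (hy : y ∈ baseSet D) : z ∈ closure (fiberSet D y) := by
  obtain ⟨ρ, ⟨U, hU, hpU, hρ, hsign, hd⟩, htrans⟩ := hfam.boundary (z, y) hp hy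
  have hρp : ContDiffAt ℝ ∞ ρ (z, y) := hρ.contDiffAt (hU.mem_nhds hpU)
  have hloc : ∀ᶠ x in 𝓝 (z, y), x ∈ D ↔ ρ x < 0 := by
    filter_upwards [hU.mem_nhds hpU] with x hx using hsign x hx
  have hρ0 := eq_zero_of_mem_frontier hfam.isOpen hρp.continuousAt hloc hp
  obtain ⟨v, hv⟩ := exists_fderiv_neg hd
  obtain ⟨u, hu0, hu⟩ := htrans v.2
  set w := v - u with hw
  have hw2 : w.2 = 0 := by rw [hw, Prod.snd_sub, hu, sub_self]
  have hwn : fderiv ℝ ρ (z, y) w < 0 := by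
    rw [hw, map_sub, hu0, sub_zero]
    exact hv
  have hmem := eventually_mem_of_fderiv_neg (hρp.differentiableAt (by simp)) hloc hρ0 hwn
  refine mem_closure_of_tendsto (tendsto_along z w.1) ?_
  filter_upwards [hmem] with t ht
  change (z + t • w.1, y) ∈ D
  convert ht using 1
  ext1
  · rfl
  · simp [hw2]

/-- A sphere enclosing the closure of the fiber over `y₀` misses the nearby fibers too. Each of
these contains a fixed point `z₀` inside the sphere and is connected, so it cannot have points
outside. -/
theorem IsHolomorphicFamily.locally_bounded (hfam : IsHolomorphicFamily D) {y₀ : ℂ}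
    (hy₀ : y₀ ∈ baseSet D) : ∃ R : ℝ, ∀ᶠ y in 𝓝 y₀, ∀ z, (z, y) ∈ D → ‖z‖ ≤ R := by
  obtain ⟨R₀, hR₀⟩ := (hfam.fiber y₀ hy₀).2.2.1.subset_closedBall 0
  set R := R₀ + 1 with hR
  have hsphere : ∀ᶠ y in 𝓝 y₀, ∀ z ∈ Metric.sphere (0 : Cn n) R, (z, y) ∉ D := by
    refine (isCompact_sphere _ _).eventually_forall_of_forall_eventually
      (P := fun y z => (z, y) ∉ D) fun z hz => ?_
    have hz' : ‖z‖ = R := by simpa using hz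
    have hzc : z ∉ closure (fiberSet D y₀) := by
      intro h
      have := closure_minimal hR₀ Metric.isClosed_closedBall h
      rw [mem_closedBall_zero_iff, hz'] at this
      linarith
    have hnot : (z, y₀) ∉ closure D := by
      intro h
      by_cases hzD : (z, y₀) ∈ D
      · exact hzc (subset_closure hzD)
      · exact hzc (hfam.mem_closure_fiberSet ⟨h, by rwa [hfam.isOpen.interior_eq]⟩ hy₀)
    have h1 : ∀ᶠ x in 𝓝 (z, y₀), x ∉ D := by
      filter_upwards [isClosed_closure.isOpen_compl.mem_nhds hnot] with x hx
      exact fun h => hx (subset_closure h)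
    have h2 : Tendsto (fun q : ℂ × Cn n => (q.2, q.1)) (𝓝 (y₀, z)) (𝓝 (z, y₀)) :=
      (continuous_snd.prodMk continuous_fst).tendsto _
    exact h2.eventually h1
  obtain ⟨⟨z₀, _⟩, hz₀, rfl⟩ := hy₀
  have hnear : ∀ᶠ y in 𝓝 _, (z₀, y) ∈ D :=
    (continuous_const.prodMk continuous_id).continuousAt.eventually (hfam.isOpen.mem_nhds hz₀)
  refine ⟨R, ?_⟩
  filter_upwards [hsphere, hnear] with y hy hyz z hz
  by_contra! hlt
  have hconn := (hfam.fiber y ⟨_, hz, rfl⟩).2.1.isPreconnected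
  have hz₀R : ‖z₀‖ ≤ R := by
    have : z₀ ∈ Metric.closedBall (0 : Cn n) R₀ := hR₀ hz₀
    rw [mem_closedBall_zero_iff] at this
    linarith
  obtain ⟨x, hx, hxR⟩ := hconn.intermediate_value (show z₀ ∈ fiberSet D y from hyz)
    (show z ∈ fiberSet D y from hz) continuous_norm.continuousOn ⟨hz₀R, hlt.le⟩
  exact hy x (by simpa using hxR) hx

/-- The constants at single points become one constant near `y₀`, because the nearby fibers lie in
one compact ball. -/
theorem IsHolomorphicFamily.exists_leviForm_ge (hfam : IsHolomorphicFamily D)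
    (hpsc : IsPseudoconvex D) {ρ : Cn n × ℂ → ℝ}
    (hρ : ∀ p, p.2 ∈ baseSet D → ContDiffAt ℝ ∞ ρ p)
    (hsign : ∀ p, p.2 ∈ baseSet D → (p ∈ D ↔ ρ p < 0))
    (hd : ∀ p ∈ frontier D, p.2 ∈ baseSet D → fderiv ℝ ρ p ≠ 0) {y₀ : ℂ} (hy₀ : y₀ ∈ baseSet D) :
    ∃ C : ℝ, ∀ᶠ y in 𝓝 y₀, ∀ z, (z, y) ∈ D → ∀ v,
      1 / 4 * (dNormSq ρ (z, y) v / ρ (z, y) ^ 2) - C * ‖v‖ ^ 2 ≤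
        leviForm (fun x => -Real.log (-ρ x)) (z, y) v := by
  obtain ⟨R, hR⟩ := hfam.locally_bounded hy₀
  have hpoint : ∀ z : Cn n, ∃ C : ℝ, ∀ᶠ x in 𝓝 (z, y₀), x ∈ D → ∀ v,
      1 / 4 * (dNormSq ρ x v / ρ x ^ 2) - C * ‖v‖ ^ 2 ≤
        leviForm (fun x => -Real.log (-ρ x)) x v := by
    intro z
    by_cases hzD : (z, y₀) ∈ D
    · obtain ⟨C, hC⟩ := exists_leviForm_neg_log_neg_ge_of_neg (hρ (z, y₀) hy₀)
        ((hsign (z, y₀) hy₀).1 hzD)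
      exact ⟨C, hC.mono fun x hx _ => hx⟩
    by_cases hzc : (z, y₀) ∈ closure D
    · have hzf : (z, y₀) ∈ frontier D := ⟨hzc, by rwa [hfam.isOpen.interior_eq]⟩
      refine hpsc.exists_leviForm_ge (hρ (z, y₀) hy₀) ?_ hzf (hd _ hzf hy₀)
      filter_upwards [continuousAt_snd.eventually ((isOpen_baseSet hfam.isOpen).mem_nhds hy₀)]
        with x hx using hsign x hx
    · refine ⟨0, ?_⟩
      filter_upwards [isClosed_closure.isOpen_compl.mem_nhds hzc] with x hx hxD
      exact absurd (subset_closure hxD) hx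
  have hcpt : ∃ C : ℝ, ∀ᶠ y in 𝓝 y₀, ∀ z ∈ Metric.closedBall (0 : Cn n) R, (z, y) ∈ D → ∀ v,
      1 / 4 * (dNormSq ρ (z, y) v / ρ (z, y) ^ 2) - C * ‖v‖ ^ 2 ≤
        leviForm (fun x => -Real.log (-ρ x)) (z, y) v := by
    refine (isCompact_closedBall (0 : Cn n) R).induction_on
      (p := fun s => ∃ C : ℝ, ∀ᶠ y in 𝓝 y₀, ∀ z ∈ s, (z, y) ∈ D → ∀ v,
        1 / 4 * (dNormSq ρ (z, y) v / ρ (z, y) ^ 2) - C * ‖v‖ ^ 2 ≤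
          leviForm (fun x => -Real.log (-ρ x)) (z, y) v) ?_ ?_ ?_ ?_
    · exact ⟨0, Eventually.of_forall fun y z hz => absurd hz (notMem_empty z)⟩
    · rintro s t hst ⟨C, hC⟩
      exact ⟨C, hC.mono fun y hy z hz => hy z (hst hz)⟩
    · rintro s t ⟨C₁, h₁⟩ ⟨C₂, h₂⟩
      refine ⟨max C₁ C₂, ?_⟩
      filter_upwards [h₁, h₂] with y hy₁ hy₂ z hz hzD v
      rcases hz with hz | hz
      · have := hy₁ z hz hzD v
        have : C₁ * ‖v‖ ^ 2 ≤ max C₁ C₂ * ‖v‖ ^ 2 := by gcongr; exact le_max_left _ _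
        linarith
      · have := hy₂ z hz hzD v
        have : C₂ * ‖v‖ ^ 2 ≤ max C₁ C₂ * ‖v‖ ^ 2 := by gcongr; exact le_max_right _ _
        linarith
    · intro z _
      obtain ⟨C, hC⟩ := hpoint z
      rw [nhds_prod_eq] at hC
      obtain ⟨pa, ha, pb, hb, hab⟩ := eventually_prod_iff.1 hC
      refine ⟨{z | pa z}, mem_nhdsWithin_of_mem_nhds ha, C, ?_⟩
      filter_upwards [hb] with y hy z hz hzD using hab hz hy hzD
  obtain ⟨C, hC⟩ := hcpt
  refine ⟨C, ?_⟩
  filter_upwards [hC, hR] with y hy hyR z hz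
  exact hy z (by simpa using hyR z hz) hz

/-- The exponential weight `exp(A(y) + |y|² + |z|²)`. -/
noncomputable def expWeight (n : ℕ) (A : ℂ → ℝ) (x : Cn n × ℂ) : ℝ :=
  Real.exp (A x.2 + (‖x.2‖ ^ 2 + ∑ i, ‖x.1 i‖ ^ 2))

theorem contDiffAt_expWeight {A : ℂ → ℝ} {x : Cn n × ℂ} (hA : ContDiffAt ℝ ∞ A x.2) :
    ContDiffAt ℝ ∞ (expWeight n A) x := by
  have h1 : ContDiffAt ℝ ∞ (fun x : Cn n × ℂ => A x.2) x := hA.comp x contDiffAt_snd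
  have h2 : ContDiffAt ℝ ∞ (fun x : Cn n × ℂ => ‖x.2‖ ^ 2 + ∑ i, ‖x.1 i‖ ^ 2) x := by
    refine (contDiffAt_snd.norm_sq ℝ).add (ContDiffAt.sum fun i _ => ContDiffAt.norm_sq ℝ ?_)
    fun_prop
  exact (h1.add h2).exp

/-- The function `A` may be harmonic and is constant on fibers, so its own Levi form is of no help.
The exponential turns its size into a factor in front of the Levi form of `|y|² + |z|²`, positive in
every direction. -/
theorem leviForm_expWeight_ge {A : ℂ → ℝ} {S : Set ℂ} (hA : SmoothSubharmonicOn A S)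
    {x : Cn n × ℂ} (hx : x.2 ∈ S) (v : Cn n × ℂ) :
    2 * Real.exp (A x.2) * ‖v‖ ^ 2 ≤ leviForm (expWeight n A) x v := by
  let l : Fin n → Cn n × ℂ →L[ℂ] ℂ := fun i =>
    (EuclideanSpace.proj i : Cn n →L[ℂ] ℂ).comp (ContinuousLinearMap.fst ℂ (Cn n) ℂ)
  let l₀ : Cn n × ℂ →L[ℂ] ℂ := ContinuousLinearMap.snd ℂ (Cn n) ℂ
  let h₁ : Cn n × ℂ → ℝ := fun x => A (l₀ x + 0)
  let h₂ : Cn n × ℂ → ℝ := fun x => ‖l₀ x - 0‖ ^ 2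
  let h₃ : Cn n × ℂ → ℝ := fun x => ∑ i, ‖l i x - 0‖ ^ 2
  have hc₁ : ContDiffAt ℝ 2 h₁ x := by
    have h : ContDiffAt ℝ 2 A (l₀ x + 0) := by simpa [l₀] using hA.contDiffAt_two hx
    exact h.comp x ((l₀.restrictScalars ℝ).contDiff.contDiffAt.add contDiffAt_const)
  have hc₂ : ContDiffAt ℝ 2 h₂ x := (contDiff_normSq_affine l₀ 0 2).contDiffAt
  have hc₃ : ContDiffAt ℝ 2 h₃ x :=
    ContDiffAt.sum fun i _ => (contDiff_normSq_affine (l i) 0 2).contDiffAt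
  have e : expWeight n A = fun x => Real.exp (h₁ x + (h₂ x + h₃ x)) := by
    ext x
    simp [expWeight, h₁, h₂, h₃, l, l₀]
  have hlev : leviForm (fun x => h₁ x + (h₂ x + h₃ x)) x v =
      leviForm A x.2 v.2 + (2 * ‖v.2‖ ^ 2 + ∑ i, 2 * ‖v.1 i‖ ^ 2) := by
    rw [leviForm_add hc₁ (hc₂.add hc₃), leviForm_add hc₂ hc₃]
    congr 1
    · have h : ContDiffAt ℝ 2 A (l₀ x + 0) := by simpa [l₀] using hA.contDiffAt_two hx
      have := leviForm_comp_affine l₀ 0 h v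
      simpa [l₀, h₁] using this
    congr 1
    · exact leviForm_normSq l₀ 0 x v
    · rw [leviForm_sum _ fun i _ => (contDiff_normSq_affine (l i) 0 2).contDiffAt]
      exact Finset.sum_congr rfl fun i _ => leviForm_normSq (l i) 0 x v
  -- The norm on the product is the maximum of the two norms, hence at most the Euclidean one.
  have hnorm : ‖v‖ ^ 2 ≤ ‖v.2‖ ^ 2 + ‖v.1‖ ^ 2 := by
    rw [Prod.norm_def]
    rcases max_choice ‖v.1‖ ‖v.2‖ with h | h <;> rw [h]
    · linarith [sq_nonneg ‖v.2‖]
    · linarith [sq_nonneg ‖v.1‖]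
  rw [EuclideanSpace.norm_sq_eq] at hnorm
  rw [← Finset.mul_sum] at hlev
  rw [e, leviForm_comp (hc₁.add (hc₂.add hc₃)) Real.contDiff_exp.contDiffAt, Real.deriv_exp, hlev]
  simp only [Real.deriv_exp]
  have hA0 := hA.leviForm_nonneg x.2 hx v.2
  have hexp : Real.exp (A x.2) ≤ Real.exp (h₁ x + (h₂ x + h₃ x)) := by
    refine Real.exp_le_exp.2 ?_
    have e1 : h₁ x = A x.2 := by simp [h₁, l₀]
    have e2 : 0 ≤ h₂ x := by positivity
    have e3 : 0 ≤ h₃ x := Finset.sum_nonneg fun i _ => by positivity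
    linarith
  have hpos := Real.exp_pos (h₁ x + (h₂ x + h₃ x))
  have h5 : 2 * ‖v‖ ^ 2 ≤ leviForm A x.2 v.2 + (2 * ‖v.2‖ ^ 2 + 2 * ∑ i, ‖v.1 i‖ ^ 2) := by
    linarith
  have h6 := mul_le_mul hexp h5 (by positivity) hpos.le
  have h7 : 0 ≤ 1 / 2 * Real.exp (h₁ x + (h₂ x + h₃ x)) *
      (fderiv ℝ (fun x => h₁ x + (h₂ x + h₃ x)) x v ^ 2 +
        fderiv ℝ (fun x => h₁ x + (h₂ x + h₃ x)) x (Complex.I • v) ^ 2) := by positivity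
  linarith

/-- The restriction of `i∂∂̄f` to the fibers is a complete Kähler form when it dominates the flat
metric and the differential of `-log(-ρ)`. -/
theorem isCompleteKahlerForm_fiberForm (hD : IsOpen D) {ρ f : Cn n × ℂ → ℝ} {y : ℂ}
    (hy : y ∈ baseSet D)
    (hρ : ∀ p, p.2 ∈ baseSet D → ContDiffAt ℝ ∞ ρ p)
    (hsign : ∀ p, p.2 ∈ baseSet D → (p ∈ D ↔ ρ p < 0))
    (hf : ∀ p ∈ D, ContDiffAt ℝ ∞ f p)
    (hlev : ∀ p ∈ D, ∀ v, 1 / 4 * (dNormSq ρ p v / ρ p ^ 2) + ‖v‖ ^ 2 ≤ leviForm f p v) :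
    IsCompleteKahlerForm (fiberForm (iddbar f) y) (fiberSet D y) := by
  set Ω := fiberSet D y with hΩdef
  have hΩ : IsOpen Ω := isOpen_fiberSet hD y
  let A : Cn n →L[ℂ] Cn n × ℂ := ContinuousLinearMap.inl ℂ (Cn n) ℂ
  have hA : ∀ w : Cn n, A w + ((0 : Cn n), y) = (w, y) := fun w => by simp [A]
  have hAn : ∀ w : Cn n, ‖A w‖ = ‖w‖ := fun w => by simp [A, Prod.norm_def]
  have hfy : ∀ z ∈ Ω, ContDiffAt ℝ ∞ (fun w => f (w, y)) z := fun z hz =>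
    (hf (z, y) hz).comp z (contDiffAt_id.prodMk contDiffAt_const)
  have hf2 : ∀ p ∈ D, ContDiffAt ℝ 2 f p := fun p hp => (hf p hp).of_le (by norm_cast)
  have hlevy : ∀ z ∈ Ω, ∀ v, leviForm (fun w => f (w, y)) z v = leviForm f (z, y) (A v) := by
    intro z hz v
    have h := leviForm_comp_affine A ((0 : Cn n), y) (z := z) (by rw [hA]; exact hf2 _ hz) v
    simpa only [hA] using h
  have hnn : ∀ p : Cn n × ℂ, ∀ v, 0 ≤ 1 / 4 * (dNormSq ρ p v / ρ p ^ 2) := fun p v =>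
    mul_nonneg (by norm_num) (div_nonneg (dNormSq_nonneg _ _ _) (sq_nonneg _))
  have heq : EqOn (fiberForm (iddbar f) y) (iddbar fun w => f (w, y)) Ω := fun z hz =>
    fiberForm_iddbar (hf2 (z, y) hz)
  have hherm : ∀ z ∈ Ω, ∀ v, hermSq (fiberForm (iddbar f) y z) v = leviForm f (z, y) (A v) := by
    intro z hz v
    rw [heq hz, hermSq_iddbar ((hfy z hz).of_le (by norm_cast)), hlevy z hz]
  refine ⟨(isKahlerForm_iddbar hfy fun z hz v hv => ?_).congr hΩ heq, ?_⟩
  · rw [hlevy z hz]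
    have h1 := hlev (z, y) hz (A v)
    have h2 := hnn (z, y) (A v)
    have h3 : 0 < ‖A v‖ ^ 2 := by rw [hAn]; positivity
    linarith
  intro u hu hcauchy
  have hρy : ∀ z, ContDiffAt ℝ ∞ (fun w => ρ (w, y)) z := fun z =>
    (hρ (z, y) hy).comp z (contDiffAt_id.prodMk contDiffAt_const)
  have hneg : ∀ z ∈ Ω, ρ (z, y) < 0 := fun z hz => (hsign (z, y) hy).1 hz
  -- The exhausting function is built from `ρ` rather than `f`, since `hlev` controls `dρ/ρ`. The
  -- constant `2` is the inverse square root of the factor `1/4`.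
  refine kahler_complete_of_exhaustion hΩ (h := fun z => -Real.log (-ρ (z, y))) (c := 2)
    (fun z hz => ?_) two_pos (fun z hz v => ?_) (fun z hz v => ?_) (fun w x B hw hwx hB => ?_)
    (fun z hz => ?_) u hu hcauchy
  · refine (ContDiffAt.log ((hρy z).neg.of_le (by norm_cast)) ?_).neg
    exact (neg_pos.2 (hneg z hz)).ne'
  · rw [hherm z hz]
    have h1 := hlev (z, y) hz (A v)
    have h2 := hnn (z, y) (A v)
    rw [hAn] at h1
    have h3 : ‖v‖ ≤ √(leviForm f (z, y) (A v)) := Real.le_sqrt_of_sq_le (by linarith)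
    linarith [norm_nonneg v]
  · rw [hherm z hz]
    have h1 := hlev (z, y) hz (A v)
    have hρd : HasFDerivAt ρ (fderiv ℝ ρ (z, y)) (z, y) :=
      ((hρ (z, y) hy).differentiableAt (by simp)).hasFDerivAt
    have hin : HasFDerivAt (fun w : Cn n => (w, y)) (ContinuousLinearMap.inl ℝ (Cn n) ℂ) z :=
      (hasFDerivAt_id z).prodMk (hasFDerivAt_const y z)
    have h2 : HasFDerivAt (fun w => -Real.log (-ρ (w, y))) _ z :=
      (((hρd.comp z hin).fun_neg).log (neg_pos.2 (hneg z hz)).ne').fun_neg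
    have h3 : fderiv ℝ (fun w => -Real.log (-ρ (w, y))) z v =
        -(fderiv ℝ ρ (z, y) (A v) / ρ (z, y)) := by
      rw [h2.fderiv]
      have : ContinuousLinearMap.inl ℝ (Cn n) ℂ v = A v := rfl
      simp [this]
      ring
    rw [h3, abs_neg]
    have h4 : (fderiv ℝ ρ (z, y) (A v) / ρ (z, y)) ^ 2 ≤ dNormSq ρ (z, y) (A v) / ρ (z, y) ^ 2 := by
      rw [div_pow]
      gcongr
      unfold dNormSq
      linarith [sq_nonneg (fderiv ℝ ρ (z, y) (Complex.I • A v))]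
    have h5 : |fderiv ℝ ρ (z, y) (A v) / ρ (z, y) / 2| ≤ √(leviForm f (z, y) (A v)) := by
      refine Real.abs_le_sqrt ?_
      have : 0 ≤ ‖A v‖ ^ 2 := sq_nonneg _
      rw [div_pow]
      linarith
    rw [abs_div, abs_two] at h5
    linarith
  · refine (hsign (x, y) hy).2 ?_
    have hlim : Tendsto (fun k => ρ (w k, y)) atTop (𝓝 (ρ (x, y))) :=
      (hρy x).continuousAt.tendsto.comp hwx
    -- A bound `B` on `-log(-ρ)` keeps `ρ` below `-exp(-B)`, and this passes to the limit.
    have hle : ρ (x, y) ≤ -Real.exp (-B) := by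
      refine le_of_tendsto hlim ?_
      filter_upwards [hB] with k hk
      have h1 := hneg _ (hw k)
      have h2 : -B ≤ Real.log (-ρ (w k, y)) := by linarith
      have h3 := (Real.le_log_iff_exp_le (by linarith)).1 h2
      linarith
    linarith [Real.exp_pos (-B)]
  · have hQ : ContDiffAt ℝ ∞ (fderiv ℝ (fderiv ℝ fun w => f (w, y))) z :=
      ((hfy z hz).fderiv_right (m := ∞) (by rfl)).fderiv_right (by rfl)
    refine ⟨‖fderiv ℝ (fderiv ℝ fun w => f (w, y)) z‖ + 1, by positivity, ?_⟩
    filter_upwards [ContinuousAt.norm (f := fderiv ℝ (fderiv ℝ fun w => f (w, y)))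
      hQ.continuousAt |>.eventually (gt_mem_nhds (lt_add_one _)), hΩ.mem_nhds hz] with w hw hwΩ v
    rw [hherm w hwΩ, ← hlevy w hwΩ]
    exact (le_abs_self _).trans (abs_leviForm_le hw.le v)

end Families

/-! ### Construction of the defining function. -/

theorem propositionP (n : ℕ) (D : Set (Cn n × ℂ)) (hfam : IsHolomorphicFamily D)
    (hpsc : IsPseudoconvex D) :
    ∃ r : Cn n × ℂ → ℝ, IsDefiningFunction r D ∧
      (∀ y ∈ baseSet D, IsCompleteKahlerForm (fiberForm (potentialForm r) y) (fiberSet D y)) ∧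
      (∀ p ∈ D, FormNonneg (potentialForm r p)) ∧
      (∀ y ∈ baseSet D, ∃ z ∈ fiberSet D y, FormPos (potentialForm r (z, y))) := by
  have hD := hfam.isOpen
  have hS := isOpen_baseSet hD
  have hW : IsOpen (Prod.snd ⁻¹' baseSet D : Set (Cn n × ℂ)) := hS.preimage continuous_snd
  have hDS : ∀ p ∈ D, p.2 ∈ baseSet D := fun p hp => ⟨p, hp, rfl⟩
  obtain ⟨ρ, hρ, hsign, hd⟩ := exists_global_defining hD hW (fun p hp => by
    obtain ⟨ρ, ⟨U, h1, h2, h3, h4, h5⟩, -⟩ := hfam.boundary p hp.1 hp.2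
    exact ⟨ρ, U, h1, h2, h3, h4, h5⟩)
  -- `A y` is itself an admissible constant in the boundary estimate over `y`.
  obtain ⟨A, hA, hAP⟩ := exists_subharmonic_growth hS
    (P := fun y C => ∀ z, (z, y) ∈ D → ∀ v,
      1 / 4 * (dNormSq ρ (z, y) v / ρ (z, y) ^ 2) - C * ‖v‖ ^ 2 ≤
        leviForm (fun x => -Real.log (-ρ x)) (z, y) v)
    (fun y a b hab h z hz v => by
      have := h z hz v
      have : a * ‖v‖ ^ 2 ≤ b * ‖v‖ ^ 2 := by gcongr
      linarith)
    (fun y hy => hfam.exists_leviForm_ge hpsc hρ hsign (fun p hp hp2 => hd p ⟨hp, hp2⟩) hy)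
  set G := expWeight n A with hG
  have hGs : ∀ p : Cn n × ℂ, p.2 ∈ baseSet D → ContDiffAt ℝ ∞ G p := fun p hp =>
    contDiffAt_expWeight (hA.contDiffAt _ hp)
  let r : Cn n × ℂ → ℝ := fun x => ρ x * Real.exp (-G x)
  have hrs : ∀ p : Cn n × ℂ, p.2 ∈ baseSet D → ContDiffAt ℝ ∞ r p := fun p hp =>
    (hρ p hp).mul (hGs p hp).neg.exp
  have hrsign : ∀ p : Cn n × ℂ, r p < 0 ↔ ρ p < 0 := fun p =>
    ⟨fun h => neg_of_mul_neg_left h (Real.exp_pos _).le,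
      fun h => mul_neg_of_neg_of_pos h (Real.exp_pos _)⟩
  let f : Cn n × ℂ → ℝ := fun x => -Real.log (-r x)
  have hfs : ∀ p ∈ D, ContDiffAt ℝ ∞ f p := by
    intro p hp
    have h1 := (hrsign p).2 ((hsign p (hDS p hp)).1 hp)
    exact (ContDiffAt.log (hrs p (hDS p hp)).neg (neg_pos.2 h1).ne').neg
  have hfeq : ∀ p ∈ D, f =ᶠ[𝓝 p] fun x => -Real.log (-ρ x) + G x := by
    intro p hp
    filter_upwards [hD.mem_nhds hp] with x hx
    have h1 := (hsign x (hDS x hx)).1 hx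
    change -Real.log (-(ρ x * Real.exp (-G x))) = _
    rw [← neg_mul, Real.log_mul (by linarith) (Real.exp_pos _).ne', Real.log_exp]
    ring
  have hlev : ∀ p ∈ D, ∀ v, 1 / 4 * (dNormSq ρ p v / ρ p ^ 2) + ‖v‖ ^ 2 ≤ leviForm f p v := by
    intro p hp v
    have hpS := hDS p hp
    have hlog : ContDiffAt ℝ ∞ (fun x => -Real.log (-ρ x)) p := by
      have h1 := (hsign p hpS).1 hp
      exact (ContDiffAt.log (hρ p hpS).neg (neg_pos.2 h1).ne').neg
    rw [leviForm_congr (hfeq p hp), leviForm_add (hlog.of_le (by norm_cast))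
      ((hGs p hpS).of_le (by norm_cast))]
    have h1 := hAP p.2 hpS p.1 hp v
    have h2 := leviForm_expWeight_ge hA hpS v
    have h3 := Real.add_one_le_exp (A p.2)
    have h4 := Real.exp_pos (A p.2)
    -- Since `exp A ≥ A + 1`, the weight pays for the loss `A‖v‖²` and leaves a full `‖v‖²`,
    -- whatever the sign of `A`.
    have h5 : (A p.2 + 1) * ‖v‖ ^ 2 ≤ 2 * Real.exp (A p.2) * ‖v‖ ^ 2 := by
      gcongr
      linarith
    simp only [Prod.mk.eta] at h1
    linarith
  have hpos : ∀ p ∈ D, FormPos (potentialForm r p) := by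
    intro p hp v hv
    change 0 < hermSq (iddbar f p) v
    rw [hermSq_iddbar ((hfs p hp).of_le (by norm_cast))]
    have h1 := hlev p hp v
    have h2 : 0 ≤ dNormSq ρ p v / ρ p ^ 2 := div_nonneg (dNormSq_nonneg _ _ _) (sq_nonneg _)
    have h3 : 0 < ‖v‖ ^ 2 := by positivity
    linarith
  refine ⟨r, ⟨⟨_, hW, inter_subset_right, fun p hp => (hrs p hp).contDiffWithinAt,
    fun x _ hx => (hsign x hx).trans (hrsign x).symm⟩, fun p hp hpS h0 => ?_⟩,
    fun y hy => isCompleteKahlerForm_fiberForm hD hy hρ hsign hfs hlev, fun p hp v => ?_,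
    fun y hy => ?_⟩
  · have hρp : ρ p = 0 := eq_zero_of_mem_frontier hD (hρ p hpS).continuousAt
      (by filter_upwards [hW.mem_nhds hpS] with x hx using hsign x hx) hp
    have h1 : HasFDerivAt r _ p := ((hρ p hpS).differentiableAt (by simp)).hasFDerivAt.mul
      ((hGs p hpS).neg.exp.differentiableAt (by simp)).hasFDerivAt
    -- As `ρ p = 0`, only `exp(-G) dρ` remains of `dr`.
    rw [h1.fderiv, hρp, zero_smul, zero_add] at h0
    exact hd p ⟨hp, hpS⟩ ((smul_eq_zero.1 h0).resolve_left (Real.exp_pos _).ne')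
  · rcases eq_or_ne v 0 with rfl | hv
    · change 0 ≤ hermSq (iddbar f p) 0
      rw [hermSq_iddbar ((hfs p hp).of_le (by norm_cast))]
      simp [leviForm]
    · exact (hpos p hp v hv).le
  · obtain ⟨⟨z, _⟩, hz, rfl⟩ := hy
    exact ⟨z, hz, hpos _ hz⟩
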